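/- Let $n\ge 0$. Index the rows and columns of $2n\times 2n$ matrices by $1,2,\dots,n,-n,\dots,-2,-1$ (in this order), let $J$ be the matrix with $J_{i,-i}=1$, $J_{-i,i}=-1$ for $1\le i\le n$ and zeroes elsewhere, and let $G=\mathrm{Sp}_{2n}(\mathbb C)=\{X\in \mathrm{GL}_{2n}(\mathbb C)\mid X^tJX=J\}$. Let $B\subset G$ be the subgroup of upper-triangular matrices in $G$, and let $\mathfrak n$ be the space of strictly upper-triangular matrices $X$ with $X^tJ+JX=0$. The group $B$ acts on $\mathfrak n$ by conjugation, and on the dual space $\mathfrak n^*$ by $\langle g.\lambda,x\rangle=\langle\lambda,g^{-1}xg\rangle$. Let $\Phi^+=\{\varepsilon_i\pm\varepsilon_j,\ 1\le i<j\le n\}\cup\{2\varepsilon_i,\ 1\le i\le n\}\subset\mathbb R^n$ be the set of positive roots of $C_n$. The matrices $e_{\varepsilon_i-\varepsilon_j}=e_{i,j}-e_{-j,-i}$, $e_{\varepsilon_i+\varepsilon_j}=e_{i,-j}+e_{j,-i}$, $e_{2\varepsilon_i}=e_{i,-i}$ (where $e_{a,b}$ are the matrix units) form a basis of $\mathfrak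 n$; let $(e_\alpha^*)_{\alpha\in\Phi^+}$ be the dual basis of $\mathfrak n^*$. Let $r_\alpha$ be the reflection of $\mathbb R^n$ in the hyperplane orthogonal to $\alpha$, let $W=W(C_n)$ be the group generated by all $r_\alpha$, $\alpha\in\Phi^+$, and let $l(w)$ be the smallest number of factors in an expression of $w\in W$ as a product of the fundamental reflections $r_\alpha$, $\alpha\in\{\varepsilon_1-\varepsilon_2,\dots,\varepsilon_{n-1}-\varepsilon_n,2\varepsilon_n\}$. A support of $\sigma\in W$ is a set $D\subset\Phi^+$ of pairwise orthogonal roots such that $\sigma=\prod_{\alpha\in D}r_\alpha$ and there are no $\alpha,\beta\in D$ with $\alpha-\beta\in\Phi^+$. Theorem. Let $\sigma\in W(C_n)$ satisfy $\sigma^2=1$. Then $\sigma$ has exactly one support $D=\mathrm{Supp}(\sigma)$, and the $B$-orbit $\Omega_\sigma\subset\mathfrak n^*$ of $f_\sigma=\sum_{\alpha\in D}e_\alpha^*$ has dimension (with respect to the Zariski topology) $$\dim\Omega_\sigma=l(\sigma).$$ -/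

import Mathlib

open scoped Matrix

noncomputable section

namespace TypeC

/-! ### The root system `C_n`, its Weyl group, the length function and supports -/

/-- The positive roots of `C_n`, with `ε_i` indexed by `i : Fin n`. -/
inductive PosRoot (n : ℕ) : Type
  /-- The root `ε_i - ε_j`, `i < j`. -/
  | sub (i j : Fin n) (h : i < j) : PosRoot n
  /-- The root `ε_i + ε_j`, `i < j`. -/
  | add (i j : Fin n) (h : i < j) : PosRoot n
  /-- The root `2 ε_i`. -/
  | two (i : Fin n) : PosRoot n
  deriving DecidableEq, Fintype

/-- The standard basis vector `ε_i` of `ℝ^n`. -/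
def eps {n : ℕ} (i : Fin n) : EuclideanSpace ℝ (Fin n) := EuclideanSpace.single i 1

/-- A positive root as a vector of `ℝ^n`. -/
def PosRoot.vec {n : ℕ} : PosRoot n → EuclideanSpace ℝ (Fin n)
  | .sub i j _ => eps i - eps j
  | .add i j _ => eps i + eps j
  | .two i => (2 : ℝ) • eps i

/-- The reflection `r_α` in the hyperplane orthogonal to `α`. -/
def PosRoot.refl {n : ℕ} (α : PosRoot n) :
    EuclideanSpace ℝ (Fin n) ≃ₗᵢ[ℝ] EuclideanSpace ℝ (Fin n) :=
  Submodule.reflection (Submodule.span ℝ {α.vec})ᗮ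

/-- The Weyl group `W(C_n)`, generated by the reflections in all roots (`r_{-α} = r_α`). -/
def weylGroup (n : ℕ) :
    Subgroup (EuclideanSpace ℝ (Fin n) ≃ₗᵢ[ℝ] EuclideanSpace ℝ (Fin n)) :=
  Subgroup.closure (Set.range PosRoot.refl)

/-- The fundamental roots `ε_1 - ε_2, …, ε_{n-1} - ε_n, 2 ε_n`. -/
inductive IsFundamental {n : ℕ} : PosRoot n → Prop
  | sub (i j : Fin n) (h : i < j) (hij : (j : ℕ) = i + 1) : IsFundamental (.sub i j h)
  | two (i : Fin n) (hi : (i : ℕ) + 1 = n) : IsFundamental (.two i)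

/-- The length `l(w)` of `w ∈ W(C_n)`: the least number of factors in an expression of `w` as a
product of fundamental reflections. -/
def length {n : ℕ} (w : weylGroup n) : ℕ :=
  sInf {k | ∃ L : List (PosRoot n), (∀ α ∈ L, IsFundamental α) ∧
    (L.map PosRoot.refl).prod = (w : EuclideanSpace ℝ (Fin n) ≃ₗᵢ[ℝ] EuclideanSpace ℝ (Fin n)) ∧
    L.length = k}

/-- `D` is a support of `σ`: it consists of pairwise orthogonal positive roots, `σ` is the product
of the reflections `r_α`, `α ∈ D` (they commute, so the order of the factors is irrelevant), and no
difference of two elements of `D` is a positive root. -/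
structure IsSupport {n : ℕ} (σ : weylGroup n) (D : Finset (PosRoot n)) : Prop where
  orthogonal : ∀ α ∈ D, ∀ β ∈ D, α ≠ β → inner ℝ α.vec β.vec = 0
  prod_eq : (D.toList.map PosRoot.refl).prod =
    (σ : EuclideanSpace ℝ (Fin n) ≃ₗᵢ[ℝ] EuclideanSpace ℝ (Fin n))
  sub_ne : ∀ α ∈ D, ∀ β ∈ D, ∀ γ : PosRoot n, α.vec - β.vec ≠ γ.vec

/-! ### The Borel subgroup `B` of `Sp_{2n}(ℂ)` and the space `𝔫`

Rows and columns of `2n × 2n` matrices are indexed by `1, 2, …, n, -n, …, -2, -1` in this order.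
The index `i` is `Sum.inl i` and the index `-i` is `Sum.inr i`. In this indexing the matrix with
blocks `0, s, -s, 0` (`s` the antidiagonal unit matrix) has the entries `1` at `(i, -i)` and `-1` at
`(-i, i)`, that is, it is `-Matrix.J`, and it defines the same group and the same Lie algebra as
`Matrix.J`. -/

/-- The position of an index in the list `1, 2, …, n, -n, …, -2, -1`. -/
def pos {n : ℕ} : Fin n ⊕ Fin n → ℤ
  | .inl i => i
  | .inr i => 2 * n - 1 - i

/-- The Borel subgroup `B` of all upper-triangular symplectic matrices. -/
def borel (n : ℕ) : Subgroup (Matrix.symplecticGroup (Fin n) ℂ) where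
  carrier := {g | ∀ i j, pos j < pos i → (g : Matrix (Fin n ⊕ Fin n) (Fin n ⊕ Fin n) ℂ) i j = 0}
  mul_mem' {a b} ha hb := by
    intro i j h
    exact Matrix.BlockTriangular.mul (b := pos) (M := a.1) (N := b.1)
      (fun i j h => ha i j h) (fun i j h => hb i j h) h
  one_mem' := by
    intro i j h
    exact Matrix.blockTriangular_one (b := pos) h
  inv_mem' {a} ha := by
    intro i j h
    rw [SymplecticGroup.coe_inv']
    have : Invertible (a : Matrix (Fin n ⊕ Fin n) (Fin n ⊕ Fin n) ℂ) :=
      Matrix.invertibleOfIsUnitDet _ (SymplecticGroup.symplectic_det a.2)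
    exact Matrix.blockTriangular_inv_of_blockTriangular (b := pos) (M := a.1)
      (fun i j h => ha i j h) h

/-- The space `𝔫` of all strictly upper-triangular matrices of the symplectic Lie algebra. -/
def nil (n : ℕ) : Submodule ℂ (Matrix (Fin n ⊕ Fin n) (Fin n ⊕ Fin n) ℂ) where
  carrier := {x | xᵀ * Matrix.J (Fin n) ℂ + Matrix.J (Fin n) ℂ * x = 0 ∧
    ∀ i j, pos j ≤ pos i → x i j = 0}
  add_mem' {x y} hx hy := by
    refine ⟨?_, fun i j h => by simp [hx.2 i j h, hy.2 i j h]⟩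
    have : (x + y)ᵀ * Matrix.J (Fin n) ℂ + Matrix.J (Fin n) ℂ * (x + y) =
      (xᵀ * Matrix.J (Fin n) ℂ + Matrix.J (Fin n) ℂ * x) +
      (yᵀ * Matrix.J (Fin n) ℂ + Matrix.J (Fin n) ℂ * y) := by
        rw [Matrix.transpose_add, add_mul, mul_add]; abel
    rw [this, hx.1, hy.1, add_zero]
  zero_mem' := by simp
  smul_mem' c x hx := by
    refine ⟨?_, fun i j h => by simp [hx.2 i j h]⟩
    rw [Matrix.transpose_smul, Matrix.smul_mul, Matrix.mul_smul, ← smul_add, hx.1, smul_zero]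

theorem conj_mem_nil {n : ℕ} (g : borel n) (x : nil n) :
    (g.1.1 * x.1 * (g⁻¹).1.1 : Matrix (Fin n ⊕ Fin n) (Fin n ⊕ Fin n) ℂ) ∈ nil n := by
  have h1 : g.1.1 * (g⁻¹).1.1 = 1 := congrArg (fun y : borel n => y.1.1) (mul_inv_cancel g)
  have hg := SymplecticGroup.mem_iff'.1 g.1.2
  constructor
  · set a := g.1.1
    set b := (g⁻¹).1.1
    set j := Matrix.J (Fin n) ℂ
    have e1 : aᵀ * j = j * b := by
      calc aᵀ * j = aᵀ * j * (a * b) := by rw [h1, mul_one]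
        _ = (aᵀ * j * a) * b := by simp only [mul_assoc]
        _ = j * b := by rw [hg]
    have h1t : bᵀ * aᵀ = 1 := by rw [← Matrix.transpose_mul, h1, Matrix.transpose_one]
    have e2 : j * a = bᵀ * j := by
      calc j * a = (bᵀ * aᵀ) * (j * a) := by rw [h1t, one_mul]
        _ = bᵀ * (aᵀ * j * a) := by simp only [mul_assoc]
        _ = bᵀ * j := by rw [hg]
    calc (a * x.1 * b)ᵀ * j + j * (a * x.1 * b)
        = bᵀ * (x.1ᵀ * (aᵀ * j)) + (j * a) * x.1 * b := by
          simp only [Matrix.transpose_mul, mul_assoc]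
      _ = bᵀ * (x.1ᵀ * j + j * x.1) * b := by
          rw [e1, e2]; simp only [mul_assoc, mul_add, add_mul]
      _ = 0 := by rw [x.2.1]; simp
  · intro i j hij
    rw [Matrix.mul_apply]
    refine Finset.sum_eq_zero fun l _ => ?_
    rw [Matrix.mul_apply, Finset.sum_mul]
    refine Finset.sum_eq_zero fun k _ => ?_
    by_cases hik : pos k < pos i
    · simp [g.2 i k hik]
    by_cases hkl : pos l ≤ pos k
    · simp [x.2.2 k l hkl]
    have : pos j < pos l := by omega
    exact mul_eq_zero_of_right _ ((g⁻¹).2 l j this)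

/-- The adjoint action `Ad_g(x) = g x g⁻¹` of `g ∈ B` on `𝔫`. -/
def Ad {n : ℕ} (g : borel n) : nil n →ₗ[ℂ] nil n where
  toFun x := ⟨g.1.1 * x.1 * (g⁻¹).1.1, conj_mem_nil g x⟩
  map_add' x y := by ext1; simp [mul_add, add_mul]
  map_smul' c x := by ext1; simp

/-- The action of `B` on `𝔫*` dual to the adjoint action: `⟨g.f, x⟩ = ⟨f, Ad_g⁻¹ x⟩`. -/
def coAd {n : ℕ} (g : borel n) (f : Module.Dual ℂ (nil n)) : Module.Dual ℂ (nil n) :=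
  f ∘ₗ Ad g⁻¹

/-- The `B`-orbit `Ω_f` of `f ∈ 𝔫*`. -/
def orbit {n : ℕ} (f : Module.Dual ℂ (nil n)) : Set (Module.Dual ℂ (nil n)) :=
  Set.range fun g : borel n => coAd g f

/-! ### The basis `e_α` of `𝔫` and the elements `f_D` of `𝔫*` -/

/-- The matrix `e_α`. -/
def PosRoot.mat {n : ℕ} : PosRoot n → Matrix (Fin n ⊕ Fin n) (Fin n ⊕ Fin n) ℂ
  | .sub i j _ => Matrix.single (.inl i) (.inl j) 1 - Matrix.single (.inr j) (.inr i) 1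
  | .add i j _ => Matrix.single (.inl i) (.inr j) 1 + Matrix.single (.inl j) (.inr i) 1
  | .two i => Matrix.single (.inl i) (.inr i) 1

theorem mem_nil_iff {n : ℕ} (x : Matrix (Fin n ⊕ Fin n) (Fin n ⊕ Fin n) ℂ) :
    x ∈ nil n ↔ (∀ i j, x (.inr i) (.inr j) = - x (.inl j) (.inl i)) ∧
      (∀ i j, x (.inl i) (.inr j) = x (.inl j) (.inr i)) ∧
      (∀ i j, x (.inr i) (.inl j) = 0) ∧ (∀ i j, j ≤ i → x (.inl i) (.inl j) = 0) := by
  have key : xᵀ * Matrix.J (Fin n) ℂ + Matrix.J (Fin n) ℂ * x = 0 ↔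
      (∀ i j, x (.inr i) (.inr j) = - x (.inl j) (.inl i)) ∧
      (∀ i j, x (.inl i) (.inr j) = x (.inl j) (.inr i)) ∧
      (∀ i j, x (.inr i) (.inl j) = x (.inr j) (.inl i)) := by
    obtain ⟨a, b, c, d, rfl⟩ : ∃ a b c d, x = Matrix.fromBlocks a b c d :=
      ⟨_, _, _, _, (Matrix.fromBlocks_toBlocks x).symm⟩
    rw [Matrix.J, Matrix.fromBlocks_transpose, Matrix.fromBlocks_multiply,
      Matrix.fromBlocks_multiply, Matrix.fromBlocks_add, ← Matrix.fromBlocks_zero,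
      Matrix.fromBlocks_inj]
    simp only [← Matrix.ext_iff, Matrix.add_apply, mul_zero, mul_one, zero_mul, one_mul,
      Matrix.zero_apply, zero_add, add_zero, mul_neg, neg_mul, Matrix.neg_apply,
      Matrix.transpose_apply, Matrix.fromBlocks_apply₁₁, Matrix.fromBlocks_apply₁₂,
      Matrix.fromBlocks_apply₂₁, Matrix.fromBlocks_apply₂₂]
    constructor
    · rintro ⟨h1, h2, h3, h4⟩
      exact ⟨fun i j => by linear_combination h3 j i,
        fun i j => by linear_combination h4 i j, fun i j => by linear_combination h1 j i⟩
    · rintro ⟨h1, h2, h3⟩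
      exact ⟨fun i j => by linear_combination h3 j i, fun i j => by linear_combination -h1 i j,
        fun i j => by linear_combination h1 j i, fun i j => by linear_combination h2 i j⟩
  constructor
  · rintro ⟨h, ht⟩
    obtain ⟨h1, h2, h3⟩ := key.1 h
    refine ⟨h1, h2, fun i j => ht _ _ ?_, fun i j hij => ht _ _ ?_⟩
    · simp only [pos]; omega
    · simp only [pos]; omega
  · rintro ⟨h1, h2, h3, h4⟩
    refine ⟨key.2 ⟨h1, h2, fun i j => by rw [h3, h3]⟩, ?_⟩
    rintro (i | i) (j | j) hij
    · exact h4 i j (by simp only [pos] at hij; omega)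
    · simp only [pos] at hij; omega
    · exact h3 i j
    · rw [h1, h4 j i (by simp only [pos] at hij; omega), neg_zero]

theorem PosRoot.mat_mem {n : ℕ} (α : PosRoot n) : α.mat ∈ nil n := by
  rw [mem_nil_iff]
  rcases α with ⟨i, j, h⟩ | ⟨i, j, h⟩ | ⟨i⟩ <;>
    refine ⟨fun a b => ?_, fun a b => ?_, fun a b => ?_, fun a b hab => ?_⟩ <;>
    simp only [PosRoot.mat, Matrix.add_apply, Matrix.sub_apply, Matrix.single_apply,
      Sum.inl.injEq, Sum.inr.injEq, reduceCtorEq, false_and, and_false, if_false] <;>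
    grind

/-- The entry of a matrix from `𝔫` that is its coefficient at `e_α`. -/
def PosRoot.entry {n : ℕ} : PosRoot n → (Fin n ⊕ Fin n) × (Fin n ⊕ Fin n)
  | .sub i j _ => (.inl i, .inl j)
  | .add i j _ => (.inl i, .inr j)
  | .two i => (.inl i, .inr i)

theorem PosRoot.mat_entry {n : ℕ} (α β : PosRoot n) :
    α.mat β.entry.1 β.entry.2 = if α = β then 1 else 0 := by
  rcases α with ⟨i, j, h⟩ | ⟨i, j, h⟩ | ⟨i⟩ <;> rcases β with ⟨k, l, h'⟩ | ⟨k, l, h'⟩ | ⟨k⟩ <;>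
    simp only [PosRoot.mat, PosRoot.entry, Matrix.add_apply, Matrix.sub_apply,
      Matrix.single_apply, Sum.inl.injEq, Sum.inr.injEq, reduceCtorEq, false_and, and_false,
      if_false, PosRoot.sub.injEq, PosRoot.add.injEq, PosRoot.two.injEq] <;>
    grind

theorem eq_of_entry {n : ℕ} {x y : nil n}
    (h : ∀ α : PosRoot n, x.1 α.entry.1 α.entry.2 = y.1 α.entry.1 α.entry.2) : x = y := by
  obtain ⟨x1, x2, x3, x4⟩ := (mem_nil_iff _).1 x.2
  obtain ⟨y1, y2, y3, y4⟩ := (mem_nil_iff _).1 y.2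
  have hl : ∀ i j, x.1 (.inl i) (.inl j) = y.1 (.inl i) (.inl j) := by
    intro i j
    rcases lt_or_ge i j with hij | hij
    · exact h (.sub i j hij)
    · rw [x4 i j hij, y4 i j hij]
  ext a b
  rcases a with i | i <;> rcases b with j | j
  · exact hl i j
  · rcases lt_trichotomy i j with hij | rfl | hij
    · exact h (.add i j hij)
    · exact h (.two i)
    · rw [x2 i j, y2 i j]
      exact h (.add j i hij)
  · rw [x3, y3]
  · rw [x1, y1, hl]

theorem sum_entry {n : ℕ} (c : PosRoot n → ℂ) (β : PosRoot n) :
    (∑ α, c α • (⟨α.mat, α.mat_mem⟩ : nil n)).1 β.entry.1 β.entry.2 = c β := by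
  simp [Matrix.sum_apply, PosRoot.mat_entry]

/-- The basis `(e_α)` of `𝔫` indexed by the positive roots `α`. -/
def rootBasis (n : ℕ) : Module.Basis (PosRoot n) ℂ (nil n) :=
  Module.Basis.mk (v := fun α => (⟨α.mat, α.mat_mem⟩ : nil n))
    (by
      rw [Fintype.linearIndependent_iff]
      intro c hc β
      rw [← sum_entry c β, hc]
      rfl)
    (by
      intro x _
      have hx : x = ∑ α : PosRoot n, x.1 α.entry.1 α.entry.2 • (⟨α.mat, α.mat_mem⟩ : nil n) :=
        eq_of_entry fun β => (sum_entry (fun α => x.1 α.entry.1 α.entry.2) β).symm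
      rw [hx]
      exact Submodule.sum_mem _ fun α _ =>
        Submodule.smul_mem _ _ (Submodule.subset_span ⟨α, rfl⟩))

theorem rootBasis_apply {n : ℕ} (α : PosRoot n) : (rootBasis n α).1 = α.mat := by
  simp [rootBasis]

/-- `f_D = ∑_{α ∈ D} e_α^*`, where `(e_α^*)` is the basis of `𝔫*` dual to `(e_α)`. -/
def fD {n : ℕ} (D : Finset (PosRoot n)) : Module.Dual ℂ (nil n) :=
  ∑ α ∈ D, (rootBasis n).coord α

/-! ### The Zariski topology and the dimension -/

/-- The Zariski topology on the affine space `ℂ^ι`: the closed sets are the sets of common zeros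
of sets of polynomials. -/
@[reducible]
def zariski (ι : Type) : TopologicalSpace (ι → ℂ) :=
  TopologicalSpace.ofClosed
    {Z | ∃ S : Set (MvPolynomial ι ℂ), Z = {v | ∀ p ∈ S, MvPolynomial.eval v p = 0}}
    ⟨{1}, by ext; simp⟩
    (by
      intro A hA
      refine ⟨{p | ∃ Z ∈ A, ∀ v ∈ Z, MvPolynomial.eval v p = 0}, ?_⟩
      ext v
      constructor
      · rintro hv p ⟨Z, hZ, hp⟩
        exact hp v (hv Z hZ)
      · intro hv Z hZ
        obtain ⟨S, rfl⟩ := hA hZ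
        intro p hp
        exact hv p ⟨_, hZ, fun w hw => hw p hp⟩)
    (by
      rintro _ ⟨S, rfl⟩ _ ⟨T, rfl⟩
      refine ⟨{r | ∃ p ∈ S, ∃ q ∈ T, r = p * q}, ?_⟩
      ext v
      constructor
      · rintro (hv | hv) _ ⟨p, hp, q, hq, rfl⟩
        · simp [hv p hp]
        · simp [hv q hq]
      · intro hv
        by_contra hcon
        simp only [Set.mem_union, Set.mem_ofPred_eq, not_or, not_forall] at hcon
        obtain ⟨⟨p, hp, hp'⟩, ⟨q, hq, hq'⟩⟩ := hcon
        have := hv (p * q) ⟨p, hp, q, hq, rfl⟩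
        rw [map_mul] at this
        exact (mul_ne_zero hp' hq') this)

/-- The Zariski topology on `𝔫*`, in the coordinates `f ↦ (f(e_α))`. -/
@[reducible]
def zariskiDual (n : ℕ) : TopologicalSpace (Module.Dual ℂ (nil n)) :=
  TopologicalSpace.induced (fun f (α : PosRoot n) => f (rootBasis n α)) (zariski (PosRoot n))

/-- The dimension of a subset of `𝔫*`: its Krull dimension in the topology induced by the Zariski
topology, that is, the supremum of the lengths of chains of irreducible relatively closed
subsets. -/
def zariskiDim {n : ℕ} (Y : Set (Module.Dual ℂ (nil n))) : WithBot ℕ∞ :=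
  letI : TopologicalSpace Y := TopologicalSpace.induced Subtype.val (zariskiDual n)
  topologicalKrullDim Y

end TypeC

end

/-! Everything is expressed in signed indices `±i`, ordered by `wt`, with signed unit vectors `sv`.
A positive root is an unordered pair of signed indices with positive weight sum, and an element of
`W` is a permutation `τ` of signed indices commuting with the change of sign. For an involution, the
roots of a support must be the pairs `{r, -τ r}` with `wt (τ r) < wt r` (`IsSupport.eq_suppOf`,
`isSupport_suppOf`), and the length is the number of pairs of positive weight sum that `τ` makes
negative (`length_eq_card_inversions`).

Up to signs and relabelling, the inverse of a symplectic matrix is its transpose. The coadjoint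
action therefore becomes `M ↦ g M gᵀ` on symmetric matrices of which only the entries `(r, q)` with
`wt r + wt q > 0` are kept (`mult_mul_coAd`, `trunc_conj`), and `f_σ` becomes a symmetric `Q`
supported exactly at the places `(r, -τ r)` with `wt (τ r) < wt r`.

The orbit is a product of copies of `ℂ` and `ℂ \ {0}`, one for each inversion (`IsDatum.isCell`).
This is an induction that removes the largest index `a`, its partner `m = -τ a`, and their
negatives. The row `a` of `g` is diagonal, so the row `a` of `g Q gᵀ` shows the column `m` of `g` up
to a nonzero factor. If `m ≠ -a`, a unipotent matrix depending regularly on that row clears the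
column (`IsTop.straighten`); what remains is a free row `m` and a point of the orbit for the other
indices. The free entries of the two rows are as many as the inversions involving `a` or `m`
(`IsTop.card_inversions`, `IsTop.card_topSet`). If `m = -a`, the removal changes nothing.

Coordinates that are regular in one another define the same Zariski topology, and a cell has the
expected Krull dimension: vanishing ideals bound it above, a chain of coordinate subspaces bounds it
below (`krullDim_of_isCell`). -/

noncomputable section

namespace TypeC

/-! ### Regular functions and cells -/

section Regular

variable {X Y ι κ : Type*}

/-- The functions on `X` that are quotients of polynomials in a family `F` of functions on `X`,
the denominators having no zeros. -/
def Reg (F : X → ι → ℂ) : Subalgebra ℂ (X → ℂ) where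
  carrier := {f | ∃ p q : MvPolynomial ι ℂ, ∀ x, MvPolynomial.eval (F x) q ≠ 0 ∧
    f x * MvPolynomial.eval (F x) q = MvPolynomial.eval (F x) p}
  mul_mem' := by
    rintro f g ⟨p, q, h⟩ ⟨p', q', h'⟩
    refine ⟨p * p', q * q', fun x => ⟨?_, ?_⟩⟩
    · rw [map_mul]; exact mul_ne_zero (h x).1 (h' x).1
    · rw [map_mul, map_mul, ← (h x).2, ← (h' x).2, Pi.mul_apply]; ring
  add_mem' := by
    rintro f g ⟨p, q, h⟩ ⟨p', q', h'⟩
    refine ⟨p * q' + q * p', q * q', fun x => ⟨?_, ?_⟩⟩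
    · rw [map_mul]; exact mul_ne_zero (h x).1 (h' x).1
    · rw [map_add, map_mul, map_mul, map_mul, ← (h x).2, ← (h' x).2, Pi.add_apply]; ring
  algebraMap_mem' := by
    intro c
    exact ⟨MvPolynomial.C c, 1, fun x => by simp⟩

theorem coord_mem_reg (F : X → ι → ℂ) (i : ι) : (fun x => F x i) ∈ Reg F :=
  ⟨MvPolynomial.X i, 1, fun x => by simp⟩

theorem const_mem_reg (F : X → ι → ℂ) (c : ℂ) : (fun _ => c) ∈ Reg F :=
  (Reg F).algebraMap_mem c

theorem add_mem_reg {F : X → ι → ℂ} {f g : X → ℂ} (hf : f ∈ Reg F) (hg : g ∈ Reg F) :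
    (fun x => f x + g x) ∈ Reg F := (Reg F).add_mem hf hg

theorem neg_mem_reg {F : X → ι → ℂ} {f : X → ℂ} (hf : f ∈ Reg F) :
    (fun x => - f x) ∈ Reg F := (Reg F).neg_mem hf

theorem mul_mem_reg {F : X → ι → ℂ} {f g : X → ℂ} (hf : f ∈ Reg F) (hg : g ∈ Reg F) :
    (fun x => f x * g x) ∈ Reg F := (Reg F).mul_mem hf hg

theorem sum_mem_reg {F : X → ι → ℂ} {J : Type*} (s : Finset J) {f : J → X → ℂ}
    (hf : ∀ j ∈ s, f j ∈ Reg F) : (fun x => ∑ j ∈ s, f j x) ∈ Reg F := by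
  have := (Reg F).sum_mem hf
  convert this using 1
  ext x
  simp

theorem div_mem_reg {F : X → ι → ℂ} {f g : X → ℂ} (hf : f ∈ Reg F) (hg : g ∈ Reg F)
    (h0 : ∀ x, g x ≠ 0) : (fun x => f x / g x) ∈ Reg F := by
  obtain ⟨p, q, h⟩ := hf
  obtain ⟨p', q', h'⟩ := hg
  have hp' : ∀ x, MvPolynomial.eval (F x) p' ≠ 0 := fun x => by
    rw [← (h' x).2]; exact mul_ne_zero (h0 x) (h' x).1
  refine ⟨p * q', q * p', fun x => ⟨?_, ?_⟩⟩
  · rw [map_mul]; exact mul_ne_zero (h x).1 (hp' x)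
  · rw [map_mul, map_mul, ← (h x).2, ← (h' x).2]
    field_simp [h0 x]

theorem eval_mem_reg {F : X → ι → ℂ} {G : X → κ → ℂ} (hG : ∀ k, (fun x => G x k) ∈ Reg F)
    (p : MvPolynomial κ ℂ) : (fun x => MvPolynomial.eval (G x) p) ∈ Reg F := by
  induction p using MvPolynomial.induction_on with
  | C a => simpa using const_mem_reg F a
  | add p q hp hq => simpa using add_mem_reg hp hq
  | mul_X p k hp => simpa using mul_mem_reg hp (hG k)

theorem reg_le {F : X → ι → ℂ} {G : X → κ → ℂ} (hG : ∀ k, (fun x => G x k) ∈ Reg F) :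
    Reg G ≤ Reg F := by
  rintro f ⟨p, q, h⟩
  have : f = fun x => MvPolynomial.eval (G x) p / MvPolynomial.eval (G x) q := by
    ext x
    rw [eq_div_iff (h x).1, (h x).2]
  rw [this]
  exact div_mem_reg (eval_mem_reg hG p) (eval_mem_reg hG q) fun x => (h x).1

theorem comp_mem_reg {F : X → ι → ℂ} {f : X → ℂ} (hf : f ∈ Reg F) (π : Y → X) :
    (fun y => f (π y)) ∈ Reg fun y => F (π y) := by
  obtain ⟨p, q, h⟩ := hf
  exact ⟨p, q, fun y => h (π y)⟩

theorem eq_of_mem_reg {F : X → ι → ℂ} {f : X → ℂ} (hf : f ∈ Reg F) {x y : X} (h : F x = F y) :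
    f x = f y := by
  obtain ⟨p, q, hpq⟩ := hf
  have h1 := hpq x
  have h2 := hpq y
  rw [h] at h1
  exact mul_right_cancel₀ h1.1 (h1.2.trans h2.2.symm)

/-- Points of affine space with nonzero coordinates at the places in `E`. -/
def torusCell (E : Set κ) : Set (κ → ℂ) := {v | ∀ e ∈ E, v e ≠ 0}

/-- The family `F` of functions on `X` identifies its image with a product of `k` factors, each of
them `ℂ` or `ℂ \ {0}`. -/
def IsCell (F : X → ι → ℂ) (k : ℕ) : Prop :=
  ∃ (κ : Type) (_ : Fintype κ) (E : Set κ) (G : X → κ → ℂ), Fintype.card κ = k ∧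
    (∀ k, (fun x => G x k) ∈ Reg F) ∧ (∀ i, (fun x => F x i) ∈ Reg G) ∧
    Set.range G = torusCell E

theorem IsCell.congr {F : X → ι → ℂ} {F' : X → κ → ℂ} {k : ℕ} (h : IsCell F k)
    (h1 : ∀ k, (fun x => F' x k) ∈ Reg F) (h2 : ∀ i, (fun x => F x i) ∈ Reg F') :
    IsCell F' k := by
  obtain ⟨κ', i, E, G, hc, hG, hF, hr⟩ := h
  exact ⟨κ', i, E, G, hc, fun k => reg_le h2 (hG k), fun k => reg_le hF (h1 k), hr⟩

/-- The components of `G` are rational in `F ∘ π`, so `G` is constant on the fibres of `π`.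
Restricting it along an arbitrary set-theoretic section loses no values. -/
theorem IsCell.of_surjective {F : X → ι → ℂ} {k : ℕ} {π : Y → X} (hπ : Function.Surjective π)
    (h : IsCell (fun y => F (π y)) k) : IsCell F k := by
  obtain ⟨κ', i, E, G, hc, hG, hF, hr⟩ := h
  obtain ⟨s, hs⟩ := hπ.hasRightInverse
  refine ⟨κ', i, E, fun x => G (s x), hc, fun k => ?_, fun k => ?_, ?_⟩
  · simpa [hs _] using comp_mem_reg (hG k) s
  · simpa [hs _] using comp_mem_reg (hF k) s
  · rw [← hr]
    refine subset_antisymm (by rintro _ ⟨x, rfl⟩; exact ⟨_, rfl⟩) ?_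
    rintro _ ⟨y, rfl⟩
    refine ⟨π y, funext fun k => ?_⟩
    exact eq_of_mem_reg (hG k) (by simp [hs _])

end Regular

/-! ### The Krull dimension of a cell -/

section Dimension

/-- The affine space `ℂ^κ` with the Zariski topology. -/
structure ZariskiSpace (κ : Type) : Type where
  /-- The coordinates of a point. -/
  coord : κ → ℂ

instance (κ : Type) : TopologicalSpace (ZariskiSpace κ) :=
  TopologicalSpace.induced ZariskiSpace.coord (zariski κ)

variable {κ ι : Type}

theorem isClosed_zariski_iff {Z : Set (ZariskiSpace κ)} :
    IsClosed Z ↔ ∃ S : Set (MvPolynomial κ ℂ),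
      Z = {v | ∀ p ∈ S, MvPolynomial.eval v.coord p = 0} := by
  have key : ∀ Z' : Set (κ → ℂ), @IsClosed _ (zariski κ) Z' ↔ ∃ S : Set (MvPolynomial κ ℂ),
      Z' = {v | ∀ p ∈ S, MvPolynomial.eval v p = 0} := fun Z' => by
    rw [← @isOpen_compl_iff _ _ (zariski κ)]
    change Z'ᶜᶜ ∈ _ ↔ _
    rw [compl_compl]
    rfl
  rw [@isClosed_induced_iff _ _ (zariski κ)]
  constructor
  · rintro ⟨Z', h, rfl⟩
    obtain ⟨S, rfl⟩ := (key Z').1 h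
    exact ⟨S, rfl⟩
  · rintro ⟨S, rfl⟩
    exact ⟨_, (key _).2 ⟨S, rfl⟩, rfl⟩

theorem isClosed_zeros (p : MvPolynomial κ ℂ) :
    IsClosed {v : ZariskiSpace κ | MvPolynomial.eval v.coord p = 0} :=
  isClosed_zariski_iff.2 ⟨{p}, by simp⟩

theorem continuous_zariski {X : Type*} [TopologicalSpace X] {f : X → ZariskiSpace κ}
    (h : ∀ p : MvPolynomial κ ℂ, IsClosed {x | MvPolynomial.eval (f x).coord p = 0}) :
    Continuous f := by
  refine continuous_iff_isClosed.2 fun Z hZ => ?_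
  obtain ⟨S, rfl⟩ := isClosed_zariski_iff.1 hZ
  have : f ⁻¹' {v | ∀ p ∈ S, MvPolynomial.eval v.coord p = 0} =
      ⋂ p ∈ S, {x | MvPolynomial.eval (f x).coord p = 0} := by
    ext x; simp
  rw [this]
  exact isClosed_biInter fun p _ => h p

theorem induced_zariskiSpace {X : Type*} (F : X → ι → ℂ) :
    TopologicalSpace.induced (fun x => ZariskiSpace.mk (F x)) inferInstance =
      TopologicalSpace.induced F (zariski ι) :=
  induced_compose (tγ := zariski ι)

/-- A polynomial in `G` is a fraction of polynomials in `F` with a denominator that never vanishes,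
so its zero set is that of the numerator. -/
theorem induced_le_of_reg {X : Type*} {F : X → ι → ℂ} {G : X → κ → ℂ}
    (hG : ∀ k, (fun x => G x k) ∈ Reg F) :
    TopologicalSpace.induced F (zariski ι) ≤ TopologicalSpace.induced G (zariski κ) := by
  rw [← induced_zariskiSpace F, ← induced_zariskiSpace G, ← continuous_iff_le_induced]
  let _ : TopologicalSpace X :=
    TopologicalSpace.induced (fun x => ZariskiSpace.mk (F x)) inferInstance
  have hF : Continuous (fun x => ZariskiSpace.mk (F x)) := continuous_induced_dom
  refine continuous_zariski fun p => ?_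
  obtain ⟨r, s, h⟩ := eval_mem_reg hG p
  convert (isClosed_zeros r).preimage hF using 1
  ext x
  simp only [Set.mem_ofPred_eq, Set.mem_preimage]
  rw [← (h x).2, mul_eq_zero, or_iff_left (h x).1]

/-- The ideal of polynomials vanishing on a set. -/
def vanishing (Z : Set (ZariskiSpace κ)) : Ideal (MvPolynomial κ ℂ) where
  carrier := {p | ∀ v ∈ Z, MvPolynomial.eval v.coord p = 0}
  add_mem' hp hq v hv := by rw [map_add, hp v hv, hq v hv, add_zero]
  zero_mem' v _ := map_zero _
  smul_mem' c p hp v hv := by rw [smul_eq_mul, map_mul, hp v hv, mul_zero]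

theorem vanishing_isPrime {Z : Set (ZariskiSpace κ)} (hZ : IsIrreducible Z) :
    (vanishing Z).IsPrime := by
  refine ⟨fun h => ?_, fun {p q} hpq => ?_⟩
  · obtain ⟨v, hv⟩ := hZ.nonempty
    have : (1 : MvPolynomial κ ℂ) ∈ vanishing Z := h ▸ Submodule.mem_top
    simpa using this v hv
  · refine isPreirreducible_iff_isClosed_union_isClosed.1 hZ.isPreirreducible _ _
      (isClosed_zeros p) (isClosed_zeros q) fun v hv => ?_
    have := hpq v hv
    rwa [map_mul, mul_eq_zero] at this

/-- Taking vanishing ideals reverses inclusions, and strictly so because a closed set is recovered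
from its ideal. For this inequality it is irrelevant which primes arise in this way. -/
theorem krullDim_zariskiSpace_le [Fintype κ] :
    topologicalKrullDim (ZariskiSpace κ) ≤ Fintype.card κ := by
  have h1 : topologicalKrullDim (ZariskiSpace κ) ≤
      Order.krullDim (PrimeSpectrum (MvPolynomial κ ℂ))ᵒᵈ := by
    refine Order.krullDim_le_of_strictMono (fun Z => OrderDual.toDual
      ⟨vanishing (Z : Set (ZariskiSpace κ)), vanishing_isPrime Z.isIrreducible⟩) ?_
    intro Z Z' h
    obtain ⟨hle, hne⟩ := lt_iff_le_not_ge.1 h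
    rw [OrderDual.toDual_lt_toDual]
    refine lt_iff_le_not_ge.2 ⟨fun p hp v hv => hp v (hle hv), fun hge => hne fun v hv => ?_⟩
    obtain ⟨S, hS⟩ := isClosed_zariski_iff.1 Z.isClosed
    have : v ∈ (Z : Set (ZariskiSpace κ)) := by
      rw [hS]
      intro p hp
      refine hge (x := p) (fun w hw => ?_) v hv
      rw [hS] at hw
      exact hw p hp
    exact this
  rw [Order.krullDim_orderDual] at h1
  refine h1.trans (le_of_eq ?_)
  change ringKrullDim (MvPolynomial κ ℂ) = _
  rw [MvPolynomial.ringKrullDim_of_isNoetherianRing, ringKrullDim_eq_zero_of_field]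
  simp

/-- If two closed sets cover the cell and neither contains it, each has an equation, `p` and `p'`,
that is not identically zero. Then `p * p' * ∏ X k` vanishes everywhere: on the cell by the
covering, off the cell because some coordinate is zero. Over an infinite field this makes a product
of nonzero polynomials zero. -/
theorem isIrreducible_torusCell [Finite κ] (E : Set κ) :
    IsIrreducible {v : ZariskiSpace κ | v.coord ∈ torusCell E} := by
  classical
  have := Fintype.ofFinite κ
  refine ⟨⟨⟨fun _ => 1⟩, fun _ _ => one_ne_zero⟩, ?_⟩
  rw [isPreirreducible_iff_isClosed_union_isClosed]
  intro Z Z' hZ hZ' h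
  obtain ⟨S, rfl⟩ := isClosed_zariski_iff.1 hZ
  obtain ⟨S', rfl⟩ := isClosed_zariski_iff.1 hZ'
  by_contra! hcon
  obtain ⟨h1, h2⟩ := hcon
  rw [Set.not_subset] at h1 h2
  obtain ⟨v, -, hv⟩ := h1
  obtain ⟨v', -, hv'⟩ := h2
  simp only [Set.mem_ofPred_eq, not_forall] at hv hv'
  obtain ⟨p, hp, hpv⟩ := hv
  obtain ⟨p', hp', hpv'⟩ := hv'
  have hne : p * p' * ∏ k, MvPolynomial.X k ≠ 0 := by
    refine mul_ne_zero (mul_ne_zero ?_ ?_) (Finset.prod_ne_zero_iff.2 fun k _ =>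
      MvPolynomial.X_ne_zero k)
    · rintro rfl; exact hpv (map_zero _)
    · rintro rfl; exact hpv' (map_zero _)
  apply hne
  refine MvPolynomial.funext fun w => ?_
  rw [map_zero, map_mul, map_mul, map_prod]
  by_cases hw : w ∈ torusCell E
  · rcases h (show ZariskiSpace.mk w ∈ _ from hw) with hw | hw
    · rw [show MvPolynomial.eval w p = 0 from hw p hp]; ring
    · rw [show MvPolynomial.eval w p' = 0 from hw p' hp']; ring
  · simp only [torusCell, Set.mem_ofPred_eq, not_forall, not_not] at hw
    obtain ⟨k, -, hk⟩ := hw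
    rw [Finset.prod_eq_zero (Finset.mem_univ k) (by simpa using hk), mul_zero]

/-- The map `π k` keeps the first `k` coordinates and sets the others to `1`, a value permitted also
where zero is not. The closures of the images of these maps form the required chain. -/
theorem le_krullDim_torusCell [Fintype κ] (E : Set κ) :
    (Fintype.card κ : WithBot ℕ∞) ≤
      topologicalKrullDim {v : ZariskiSpace κ | v.coord ∈ torusCell E} := by
  classical
  obtain ⟨e⟩ := Fintype.truncEquivFin κ |>.nonempty
  set T : Set (ZariskiSpace κ) := {v | v.coord ∈ torusCell E}
  have hirr : IsIrreducible (Set.univ : Set T) :=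
    have := Subtype.irreducibleSpace (isIrreducible_torusCell E)
    IrreducibleSpace.isIrreducible_univ T
  let π : ℕ → T → T := fun k v =>
    ⟨⟨fun x => if (e x : ℕ) < k then v.1.coord x else 1⟩, fun x hx => by
      dsimp only; split_ifs
      exacts [v.2 x hx, one_ne_zero]⟩
  have hπ : ∀ k, Continuous (π k) := by
    intro k
    refine Continuous.subtype_mk (continuous_zariski fun p => ?_) _
    have hv : Continuous (fun v : T => v.1) := continuous_subtype_val
    have hreg : ∀ x, (fun v : T => (π k v).1.coord x) ∈ Reg fun v : T => v.1.coord := by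
      intro x
      by_cases hx : (e x : ℕ) < k
      · simpa [π, hx] using coord_mem_reg (fun v : T => v.1.coord) x
      · simpa [π, hx] using const_mem_reg (fun v : T => v.1.coord) 1
    obtain ⟨r, s, h⟩ := eval_mem_reg hreg p
    convert (isClosed_zeros r).preimage hv using 1
    ext v
    have hv := h v
    simp only [Set.mem_ofPred_eq, Set.mem_preimage, ← hv.2, mul_eq_zero, or_iff_left hv.1]
    rfl
  let C : Fin (Fintype.card κ + 1) → TopologicalSpace.IrreducibleCloseds T := fun k =>
    ⟨closure (Set.range (π k)), by
      rw [← Set.image_univ]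
      exact (hirr.image _ (hπ k).continuousOn).closure, isClosed_closure⟩
  have hmono : StrictMono C := by
    rw [Fin.strictMono_iff_lt_succ]
    intro i
    have hcl : IsClosed {v : T | v.1.coord (e.symm i) = 1} := by
      have hv : Continuous (fun v : T => v.1) := continuous_subtype_val
      convert (isClosed_zeros (MvPolynomial.X (e.symm i) - 1 : MvPolynomial κ ℂ)).preimage hv
        using 1
      ext v
      simp [sub_eq_zero]
    refine lt_iff_le_not_ge.2 ⟨?_, fun h => ?_⟩
    · refine closure_mono ?_
      rintro _ ⟨v, rfl⟩
      refine ⟨π i v, Subtype.ext (congrArg ZariskiSpace.mk (funext fun x => ?_))⟩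
      simp only [π, Fin.val_succ, Fin.val_castSucc]
      split_ifs <;> first | rfl | omega
    · have h2 : closure (Set.range (π i.castSucc)) ⊆ {v : T | v.1.coord (e.symm i) = 1} := by
        refine closure_minimal ?_ hcl
        rintro _ ⟨v, rfl⟩
        simp [π]
      -- The value `2` in the newly freed coordinate keeps this point out of the smaller closure,
      -- where that coordinate is `1`.
      have h3 : π i.succ ⟨⟨fun _ => 2⟩, fun _ _ => two_ne_zero⟩ ∈
          {v : T | v.1.coord (e.symm i) = 1} := h2 (h (subset_closure ⟨_, rfl⟩))
      simp [π] at h3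
  exact Order.LTSeries.length_le_krullDim (LTSeries.mk (Fintype.card κ) C hmono)

/-- The map `G` into affine space is inducing, which gives the upper bound. A section of `G` over
the torus cell is inducing as well, since its composite with `G` is the inclusion, and this gives
the lower bound. -/
theorem krullDim_of_isCell {X : Type*} [t : TopologicalSpace X] {F : X → ι → ℂ} {k : ℕ}
    (ht : t = TopologicalSpace.induced F (zariski ι))
    (h : IsCell F k) : topologicalKrullDim X = k := by
  obtain ⟨κ, _, E, G, rfl, hG, hF', hr⟩ := h
  have hind : Topology.IsInducing (fun x => ZariskiSpace.mk (G x)) :=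
    ⟨(ht.trans (le_antisymm (induced_le_of_reg hG) (induced_le_of_reg hF'))).trans
      (induced_zariskiSpace G).symm⟩
  refine le_antisymm (hind.topologicalKrullDim_le.trans krullDim_zariskiSpace_le) ?_
  refine (le_krullDim_torusCell E).trans ?_
  have hs : ∀ v : {v : ZariskiSpace κ | v.coord ∈ torusCell E}, ∃ x, G x = v.1.coord := fun v =>
    hr.symm.subset v.2
  choose s hs using hs
  have hs' : Topology.IsInducing ((fun x => ZariskiSpace.mk (G x)) ∘ s) := by
    have : (fun x => ZariskiSpace.mk (G x)) ∘ s = Subtype.val :=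
      funext fun v => congrArg ZariskiSpace.mk (hs v)
    rw [this]
    exact Topology.IsInducing.subtypeVal
  exact (hind.of_comp_iff.1 hs').topologicalKrullDim_le

end Dimension

/-! ### Signed indices and signed unit vectors -/

section Signed

variable {n : ℕ}

/-- The weight of a signed index: a strictly monotone function of its position that changes the
sign when the index does. -/
def wt : Fin n ⊕ Fin n → ℤ
  | .inl i => i - n
  | .inr i => n - i

@[simp] theorem wt_swap (r : Fin n ⊕ Fin n) : wt r.swap = - wt r := by
  rcases r with i | i <;> simp [wt]

theorem wt_injective : Function.Injective (wt : Fin n ⊕ Fin n → ℤ) := by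
  rintro (i | i) (j | j) h <;> simp only [wt] at h
  · exact congrArg Sum.inl (Fin.ext (by omega))
  · omega
  · omega
  · exact congrArg Sum.inr (Fin.ext (by omega))

theorem wt_inj {r q : Fin n ⊕ Fin n} : wt r = wt q ↔ r = q := wt_injective.eq_iff

theorem wt_ne_zero (r : Fin n ⊕ Fin n) : wt r ≠ 0 := by
  rcases r with i | i <;> simp only [wt] <;> omega

theorem wt_le (r : Fin n ⊕ Fin n) : wt r ≤ n := by
  rcases r with i | i <;> simp only [wt] <;> omega

theorem pos_lt_pos_iff {r q : Fin n ⊕ Fin n} : pos r < pos q ↔ wt r < wt q := by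
  rcases r with i | i <;> rcases q with j | j <;> simp only [wt, pos] <;> omega

/-- The vector `ε_i` for the index `-i` and `-ε_i` for the index `i`. -/
def sv : Fin n ⊕ Fin n → EuclideanSpace ℝ (Fin n)
  | .inl i => - eps i
  | .inr i => eps i

@[simp] theorem sv_swap (r : Fin n ⊕ Fin n) : sv r.swap = - sv r := by
  rcases r with i | i <;> simp [sv]

/-- The inner product of two signed unit vectors. -/
def ip (a b : ℤ) : ℤ := if a = b then 1 else if a = - b then -1 else 0

theorem inner_sv (r q : Fin n ⊕ Fin n) : inner ℝ (sv r) (sv q) = (ip (wt r) (wt q) : ℝ) := by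
  have h1 : ∀ i j : Fin n,
      inner ℝ (eps i) (eps j) = ((if (i : ℤ) = j then 1 else 0 : ℤ) : ℝ) := by
    intro i j
    simp [eps, EuclideanSpace.inner_single_left, Fin.ext_iff]
  rcases r with i | i <;> rcases q with j | j <;>
    simp only [sv, wt, inner_neg_left, inner_neg_right, h1, ip, ← Int.cast_neg, neg_neg] <;>
    congr 1 <;> split_ifs <;> omega

theorem sv_injective : Function.Injective (sv : Fin n ⊕ Fin n → _) := by
  intro r q h
  have h1 := inner_sv r q
  rw [h, inner_sv q q] at h1
  have h2 : ip (wt q) (wt q) = ip (wt r) (wt q) := by exact_mod_cast h1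
  have := wt_ne_zero q
  apply wt_injective
  simp only [ip] at h2
  split_ifs at h2 <;> omega

theorem ext_sv {v w : EuclideanSpace ℝ (Fin n) ≃ₗᵢ[ℝ] EuclideanSpace ℝ (Fin n)}
    (h : ∀ r, v (sv r) = w (sv r)) : v = w := by
  have : v.toLinearEquiv.toLinearMap = w.toLinearEquiv.toLinearMap := by
    refine (EuclideanSpace.basisFun (Fin n) ℝ).toBasis.ext fun i => ?_
    simpa [sv, eps] using h (.inr i)
  ext1 x
  exact LinearMap.congr_fun this x

/-- The larger of the two signed indices whose unit vectors have the sum `α`. -/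
def PosRoot.hi : PosRoot n → Fin n ⊕ Fin n
  | .sub i _ _ => .inr i
  | .add i _ _ => .inr i
  | .two i => .inr i

/-- The smaller of the two signed indices whose unit vectors have the sum `α`. -/
def PosRoot.lo : PosRoot n → Fin n ⊕ Fin n
  | .sub _ j _ => .inl j
  | .add _ j _ => .inr j
  | .two i => .inr i

theorem PosRoot.vec_eq (α : PosRoot n) : α.vec = sv α.hi + sv α.lo := by
  rcases α with ⟨i, j, h⟩ | ⟨i, j, h⟩ | ⟨i⟩ <;> simp [vec, hi, lo, sv, sub_eq_add_neg, two_smul]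

theorem PosRoot.lo_le_hi (α : PosRoot n) : wt α.lo ≤ wt α.hi := by
  rcases α with ⟨i, j, h⟩ | ⟨i, j, h⟩ | ⟨i⟩ <;> simp only [hi, lo, wt] <;> omega

theorem PosRoot.hi_add_lo (α : PosRoot n) : 0 < wt α.hi + wt α.lo := by
  rcases α with ⟨i, j, h⟩ | ⟨i, j, h⟩ | ⟨i⟩ <;> simp only [hi, lo, wt] <;> omega

theorem PosRoot.ext_hi_lo {α β : PosRoot n} (h1 : α.hi = β.hi) (h2 : α.lo = β.lo) : α = β := by
  rcases α with ⟨i, j, h⟩ | ⟨i, j, h⟩ | ⟨i⟩ <;> rcases β with ⟨k, l, h'⟩ | ⟨k, l, h'⟩ | ⟨k⟩ <;>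
    simp only [hi, lo, Sum.inr.injEq, Sum.inl.injEq, reduceCtorEq] at h1 h2 <;> subst h1 <;>
    first | rfl | (subst h2; first | rfl | exact absurd ‹_› (lt_irrefl _))

/-- Together with `PosRoot.ext_hi_lo` this identifies positive roots with unordered pairs of
positive weight sum, the long roots being the pairs with equal members. Questions about roots
thereby become linear arithmetic with weights. -/
theorem PosRoot.exists_hi_lo {r q : Fin n ⊕ Fin n} (h1 : wt q ≤ wt r) (h2 : 0 < wt r + wt q) :
    ∃ α : PosRoot n, α.hi = r ∧ α.lo = q := by
  rcases r with i | i
  · have : wt (Sum.inl i : Fin n ⊕ Fin n) < 0 := by simp only [wt]; omega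
    omega
  rcases q with j | j <;> simp only [wt] at h1 h2
  · exact ⟨.sub i j (by omega), rfl, rfl⟩
  · rcases (show i ≤ j by omega).eq_or_lt with rfl | hij
    · exact ⟨.two i, rfl, rfl⟩
    · exact ⟨.add i j hij, rfl, rfl⟩

/-- The permutation of the signed indices that corresponds to the reflection `r_α`. -/
def PosRoot.perm (α : PosRoot n) (r : Fin n ⊕ Fin n) : Fin n ⊕ Fin n :=
  if r = α.hi then α.lo.swap else if r = α.lo then α.hi.swap else
    if r = α.hi.swap then α.lo else if r = α.lo.swap then α.hi else r

theorem PosRoot.wt_perm (α : PosRoot n) (r : Fin n ⊕ Fin n) :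
    wt (α.perm r) = if wt r = wt α.hi then - wt α.lo else if wt r = wt α.lo then - wt α.hi else
      if wt r = - wt α.hi then wt α.lo else if wt r = - wt α.lo then wt α.hi else wt r := by
  simp only [perm, ← wt_inj, wt_swap]
  split_ifs <;> simp

theorem PosRoot.perm_perm (α : PosRoot n) (r : Fin n ⊕ Fin n) : α.perm (α.perm r) = r := by
  have h1 := α.lo_le_hi
  have h2 := α.hi_add_lo
  have h0 := wt_ne_zero α.lo
  have h3 := α.wt_perm r
  have h4 := α.wt_perm (α.perm r)
  rw [← wt_inj]
  generalize wt (α.perm (α.perm r)) = x at *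
  generalize wt (α.perm r) = y at *
  split_ifs at h3 <;> split_ifs at h4 <;> omega

theorem PosRoot.refl_apply (α : PosRoot n) (x : EuclideanSpace ℝ (Fin n)) :
    α.refl x = x - (2 * (inner ℝ α.vec x / inner ℝ α.vec α.vec)) • α.vec := by
  rw [refl, Submodule.reflection_orthogonal_apply, Submodule.reflection_singleton_apply]
  simp only [real_inner_self_eq_norm_sq, RCLike.ofReal_real_eq_id, id_eq, two_smul, two_mul,
    add_smul]
  abel

theorem PosRoot.refl_sv (α : PosRoot n) (r : Fin n ⊕ Fin n) : α.refl (sv r) = sv (α.perm r) := by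
  have h1 := α.lo_le_hi
  have h2 := α.hi_add_lo
  have h3 := wt_ne_zero α.hi
  have h4 := wt_ne_zero α.lo
  rw [refl_apply, vec_eq]
  simp only [inner_add_left, inner_add_right, inner_sv]
  -- For a long root the two summands of `α.vec` coincide and its squared norm is 4 instead of 2.
  by_cases hl : α.lo = α.hi
  · have e1 : ip (wt α.hi) (wt α.hi) = 1 := by simp [ip]
    rw [hl, e1]
    by_cases hr : r = α.hi
    · rw [hr, e1, perm, if_pos rfl, hl, sv_swap]
      module
    by_cases hr' : r = α.hi.swap
    · have e2 : ip (wt α.hi) (wt r) = -1 := by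
        rw [hr', wt_swap, ip, if_neg (by omega), if_pos (by omega)]
      rw [e2, perm, if_neg hr, hl, if_neg hr, if_pos hr', hr', sv_swap]
      push_cast
      module
    · have e2 : ip (wt α.hi) (wt r) = 0 := by
        rw [ip, if_neg (by rw [wt_inj]; exact fun h => hr h.symm),
          if_neg (fun h => hr' (wt_injective (by rw [wt_swap]; omega)))]
      rw [e2, perm, if_neg hr, hl, if_neg hr, if_neg hr', if_neg hr']
      simp
  · have hl' : wt α.lo ≠ wt α.hi := fun h => hl (wt_injective h)
    have e1 : ip (wt α.hi) (wt α.hi) = 1 := by simp [ip]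
    have e2 : ip (wt α.lo) (wt α.lo) = 1 := by simp [ip]
    have e3 : ip (wt α.hi) (wt α.lo) = 0 := by
      rw [ip, if_neg (by omega), if_neg (by omega)]
    have e4 : ip (wt α.lo) (wt α.hi) = 0 := by
      rw [ip, if_neg (by omega), if_neg (by omega)]
    rw [e1, e2, e3, e4, perm]
    simp only [← wt_inj, wt_swap]
    split_ifs with c1 c2 c3 c4
    · rw [c1, e1, e4, wt_inj.1 c1, sv_swap]; push_cast; module
    · rw [c2, e2, e3, wt_inj.1 c2, sv_swap]; push_cast; module
    · rw [← wt_swap, wt_inj] at c3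
      have e5 : ip (wt α.hi) (wt r) = -1 := by
        rw [c3, wt_swap, ip, if_neg (by omega), if_pos (by omega)]
      have e6 : ip (wt α.lo) (wt r) = 0 := by
        rw [c3, wt_swap, ip, if_neg (by omega), if_neg (by omega)]
      rw [e5, e6, c3, sv_swap]; push_cast; module
    · rw [← wt_swap, wt_inj] at c4
      have e5 : ip (wt α.hi) (wt r) = 0 := by
        rw [c4, wt_swap, ip, if_neg (by omega), if_neg (by omega)]
      have e6 : ip (wt α.lo) (wt r) = -1 := by
        rw [c4, wt_swap, ip, if_neg (by omega), if_pos (by omega)]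
      rw [e5, e6, c4, sv_swap]; push_cast; module
    · have e5 : ip (wt α.hi) (wt r) = 0 := by
        rw [ip, if_neg (by omega), if_neg (by omega)]
      have e6 : ip (wt α.lo) (wt r) = 0 := by
        rw [ip, if_neg (by omega), if_neg (by omega)]
      rw [e5, e6]; simp

/-- The isometry `w` permutes the signed unit vectors by `τ`. -/
def ActsBy (w : EuclideanSpace ℝ (Fin n) ≃ₗᵢ[ℝ] EuclideanSpace ℝ (Fin n))
    (τ : Fin n ⊕ Fin n → Fin n ⊕ Fin n) : Prop := ∀ r, w (sv r) = sv (τ r)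

theorem ActsBy.swap {w : EuclideanSpace ℝ (Fin n) ≃ₗᵢ[ℝ] EuclideanSpace ℝ (Fin n)}
    {τ : Fin n ⊕ Fin n → Fin n ⊕ Fin n} (h : ActsBy w τ) (r : Fin n ⊕ Fin n) :
    τ r.swap = (τ r).swap := by
  apply sv_injective
  rw [← h, sv_swap, sv_swap, map_neg, h]

theorem ActsBy.injective {w : EuclideanSpace ℝ (Fin n) ≃ₗᵢ[ℝ] EuclideanSpace ℝ (Fin n)}
    {τ : Fin n ⊕ Fin n → Fin n ⊕ Fin n} (h : ActsBy w τ) : Function.Injective τ := by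
  intro r q hrq
  apply sv_injective
  apply w.injective
  rw [h, h, hrq]

theorem actsBy_one : ActsBy (1 : EuclideanSpace ℝ (Fin n) ≃ₗᵢ[ℝ] EuclideanSpace ℝ (Fin n)) id :=
  fun _ => rfl

theorem ActsBy.mul {v w : EuclideanSpace ℝ (Fin n) ≃ₗᵢ[ℝ] EuclideanSpace ℝ (Fin n)}
    {τ ρ : Fin n ⊕ Fin n → Fin n ⊕ Fin n} (hv : ActsBy v τ) (hw : ActsBy w ρ) :
    ActsBy (v * w) (τ ∘ ρ) := fun r => by
  rw [LinearIsometryEquiv.coe_mul, Function.comp_apply, hw, hv, Function.comp_apply]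

theorem exists_actsBy (w : weylGroup n) : ∃ τ, ActsBy w.1 τ := by
  obtain ⟨w, hw⟩ := w
  induction hw using Subgroup.closure_induction with
  | mem x hx =>
    obtain ⟨α, rfl⟩ := hx
    exact ⟨α.perm, α.refl_sv⟩
  | one => exact ⟨id, actsBy_one⟩
  | mul x y _ _ hx hy =>
    obtain ⟨τ, hτ⟩ := hx
    obtain ⟨ρ, hρ⟩ := hy
    exact ⟨τ ∘ ρ, hτ.mul hρ⟩
  | inv x _ hx =>
    obtain ⟨τ, hτ⟩ := hx
    have hs := Finite.surjective_of_injective hτ.injective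
    obtain ⟨ρ, hρ⟩ := hs.hasRightInverse
    refine ⟨ρ, fun r => ?_⟩
    change x.symm _ = _
    rw [LinearIsometryEquiv.symm_apply_eq, hτ, hρ]

end Signed

/-! ### Supports of involutions -/

section Support

variable {n : ℕ}

/-- The signed index `r` or its opposite occurs in `α`. -/
def PosRoot.Touches (α : PosRoot n) (r : Fin n ⊕ Fin n) : Prop :=
  wt r = wt α.hi ∨ wt r = wt α.lo ∨ wt r = - wt α.hi ∨ wt r = - wt α.lo

theorem PosRoot.perm_of_not_touches {α : PosRoot n} {r : Fin n ⊕ Fin n} (h : ¬ α.Touches r) :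
    α.perm r = r := by
  simp only [Touches, not_or] at h
  rw [← wt_inj, wt_perm, if_neg h.1, if_neg h.2.1, if_neg h.2.2.1, if_neg h.2.2.2]

theorem PosRoot.touches_perm {α : PosRoot n} {r : Fin n ⊕ Fin n} (h : α.Touches r) :
    α.Touches (α.perm r) := by
  simp only [Touches] at h ⊢
  rw [wt_perm]
  split_ifs <;> omega

theorem PosRoot.inner_vec (α β : PosRoot n) : inner ℝ α.vec β.vec =
    ((ip (wt α.hi) (wt β.hi) + ip (wt α.hi) (wt β.lo) + ip (wt α.lo) (wt β.hi) +
      ip (wt α.lo) (wt β.lo) : ℤ) : ℝ) := by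
  simp only [vec_eq, inner_add_left, inner_add_right, inner_sv]
  push_cast
  ring

theorem PosRoot.inner_vec_eq_zero {α β : PosRoot n} (h : ∀ r, α.Touches r → ¬ β.Touches r) :
    inner ℝ α.vec β.vec = 0 := by
  have h1 := h α.hi (Or.inl rfl)
  have h2 := h α.lo (Or.inr (Or.inl rfl))
  simp only [Touches, not_or] at h1 h2
  rw [inner_vec]
  simp only [ip]
  rw [if_neg h1.1, if_neg h1.2.1, if_neg h2.1, if_neg h2.2.1, if_neg h1.2.2.1, if_neg h1.2.2.2,
    if_neg h2.2.2.1, if_neg h2.2.2.2]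
  simp

/-- Distinct orthogonal positive roots with a common index up to sign are `ε_i + ε_j` and `ε_i -
ε_j`. They differ by `2ε_j`, which is exactly what the last condition on a support forbids. -/
theorem hi_eq_of_orthogonal {h l h' l' r : ℤ} (h1 : l ≤ h) (h2 : 0 < h + l) (h3 : l' ≤ h')
    (h4 : 0 < h' + l') (e : ip h h' + ip h l' + ip l h' + ip l l' = 0)
    (t : r = h ∨ r = l ∨ r = - h ∨ r = - l) (t' : r = h' ∨ r = l' ∨ r = - h' ∨ r = - l') :
    h = h' ∧ l = - l' := by
  simp only [ip] at e
  split_ifs at e <;> omega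

theorem IsSupport.not_touches {σ : weylGroup n} {D : Finset (PosRoot n)} (hD : IsSupport σ D)
    {α β : PosRoot n} (hα : α ∈ D) (hβ : β ∈ D) (hne : α ≠ β) {r : Fin n ⊕ Fin n}
    (ht : α.Touches r) : ¬ β.Touches r := by
  intro ht'
  have h0 := hD.orthogonal α hα β hβ hne
  rw [PosRoot.inner_vec, Int.cast_eq_zero] at h0
  obtain ⟨h1, h2⟩ := hi_eq_of_orthogonal α.lo_le_hi α.hi_add_lo β.lo_le_hi β.hi_add_lo h0 ht ht'
  rw [wt_inj] at h1
  rw [← wt_swap, wt_inj] at h2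
  have h3 : α.vec - β.vec = (2 : ℝ) • sv α.lo := by
    rw [α.vec_eq, β.vec_eq, h1, h2, sv_swap]
    module
  -- The sign of `α.lo` decides which of the two differences is the positive root `2ε_j`.
  rcases hl : α.lo with j | j
  · refine hD.sub_ne β hβ α hα (.two j) ?_
    rw [← neg_sub, h3, hl]
    simp [sv, PosRoot.vec]
  · refine hD.sub_ne α hα β hβ (.two j) ?_
    rw [h3, hl]
    simp [sv, PosRoot.vec]

/-- No index is touched by two factors, and a reflection sends the indices it touches to indices it
touches. Hence at most one factor moves a given signed unit vector. -/
theorem prod_refl_sv {L : List (PosRoot n)}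
    (hL : L.Pairwise fun α β => ∀ r, α.Touches r → ¬ β.Touches r) (r : Fin n ⊕ Fin n) :
    (∀ α ∈ L, α.Touches r → (L.map PosRoot.refl).prod (sv r) = sv (α.perm r)) ∧
    ((∀ α ∈ L, ¬ α.Touches r) → (L.map PosRoot.refl).prod (sv r) = sv r) := by
  induction L with
  | nil => simp
  | cons β L ih =>
    rw [List.pairwise_cons] at hL
    obtain ⟨ih1, ih2⟩ := ih hL.2
    simp only [List.map_cons, List.prod_cons, LinearIsometryEquiv.coe_mul, Function.comp_apply,
      List.mem_cons, forall_eq_or_imp]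
    refine ⟨⟨fun hβ => ?_, fun α hα ht => ?_⟩, fun h => ?_⟩
    · rw [ih2 fun α hα => hL.1 α hα r hβ, PosRoot.refl_sv]
    · rw [ih1 α hα ht, PosRoot.refl_sv, PosRoot.perm_of_not_touches fun hβ => ?_]
      exact hL.1 α hα _ hβ (PosRoot.touches_perm ht)
    · rw [ih2 h.2, PosRoot.refl_sv, PosRoot.perm_of_not_touches h.1]

/-- The roots whose reflections are the factors of the involution given by `τ`. -/
def suppOf (τ : Fin n ⊕ Fin n → Fin n ⊕ Fin n) : Finset (PosRoot n) :=
  Finset.univ.filter fun α => τ α.hi = α.lo.swap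

theorem mem_suppOf {τ : Fin n ⊕ Fin n → Fin n ⊕ Fin n} {α : PosRoot n} :
    α ∈ suppOf τ ↔ τ α.hi = α.lo.swap := by simp [suppOf]

/-- The reflection in `β` moves every index that `β` touches, so `α` touches `r` too. Up to a common
sign, the two indices of the root are then `r` and the opposite of its image. -/
theorem PosRoot.eq_of_perm_eq {α β : PosRoot n} {r : Fin n ⊕ Fin n}
    (hβ : β.Touches r) (h : α.perm r = β.perm r) : α = β := by
  have h1 := α.lo_le_hi
  have h2 := α.hi_add_lo
  have h3 := β.lo_le_hi
  have h4 := β.hi_add_lo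
  have h5 := α.wt_perm r
  have h6 := β.wt_perm r
  have h7 := wt_ne_zero α.lo
  have h8 := wt_ne_zero β.lo
  rw [h] at h5
  simp only [Touches] at hβ
  have : wt α.hi = wt β.hi ∧ wt α.lo = wt β.lo := by
    generalize wt (β.perm r) = x at *
    split_ifs at h5 <;> split_ifs at h6 <;> omega
  exact ext_hi_lo (wt_injective this.1) (wt_injective this.2)

theorem IsSupport.pairwise {σ : weylGroup n} {D : Finset (PosRoot n)} (hD : IsSupport σ D) :
    D.toList.Pairwise fun α β => ∀ r, α.Touches r → ¬ β.Touches r := by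
  refine D.nodup_toList.imp_of_mem fun hα hβ hne r => ?_
  exact hD.not_touches (Finset.mem_toList.1 hα) (Finset.mem_toList.1 hβ) hne

theorem IsSupport.eq_suppOf {σ : weylGroup n} {D : Finset (PosRoot n)} (hD : IsSupport σ D)
    {τ : Fin n ⊕ Fin n → Fin n ⊕ Fin n} (hτ : ActsBy σ.1 τ) : D = suppOf τ := by
  have key := fun r => prod_refl_sv hD.pairwise r
  rw [hD.prod_eq] at key
  ext α
  rw [mem_suppOf]
  constructor
  · intro hα
    have := (key α.hi).1 α (Finset.mem_toList.2 hα) (Or.inl rfl)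
    rw [hτ] at this
    rw [sv_injective this, PosRoot.perm, if_pos rfl]
  · intro h
    have hperm : α.perm α.hi = α.lo.swap := by rw [PosRoot.perm, if_pos rfl]
    by_cases hex : ∃ β ∈ D, β.Touches α.hi
    · obtain ⟨β, hβ, ht⟩ := hex
      have := (key α.hi).1 β (Finset.mem_toList.2 hβ) ht
      rw [hτ] at this
      have h2 := sv_injective this
      rw [h, ← hperm] at h2
      rwa [PosRoot.eq_of_perm_eq ht h2]
    -- An untouched `α.hi` is fixed by `τ`, so `α.hi` and `α.lo` are opposite, against their
    -- positive weight sum.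
    · push Not at hex
      have := (key α.hi).2 fun β hβ => hex β (Finset.mem_toList.1 hβ)
      rw [hτ] at this
      have h2 := congrArg wt ((sv_injective this).symm.trans h)
      rw [wt_swap] at h2
      have := α.hi_add_lo
      omega

theorem perm_eq_of_mem_suppOf {τ : Fin n ⊕ Fin n → Fin n ⊕ Fin n}
    (hswap : ∀ r, τ r.swap = (τ r).swap) (hinv : ∀ r, τ (τ r) = r) {α : PosRoot n}
    (hα : α ∈ suppOf τ) {r : Fin n ⊕ Fin n} (ht : α.Touches r) : α.perm r = τ r := by
  rw [mem_suppOf] at hα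
  have hlo : τ α.lo = α.hi.swap := by
    have := congrArg τ hα
    rw [hinv, hswap] at this
    rw [this, Sum.swap_swap]
  have h0 := α.hi_add_lo
  have h1 := α.lo_le_hi
  rw [← wt_inj, α.wt_perm]
  rcases ht with h | h | h | h
  · rw [if_pos h, wt_inj.1 h, hα, wt_swap]
  · have h' := h
    rw [wt_inj] at h
    subst h
    rw [hlo, wt_swap]
    split_ifs <;> omega
  · rw [← wt_swap, wt_inj] at h
    subst h
    rw [hswap, hα, Sum.swap_swap, wt_swap]
    split_ifs <;> omega
  · rw [← wt_swap, wt_inj] at h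
    subst h
    rw [hswap, hlo, Sum.swap_swap, wt_swap]
    have := wt_ne_zero α.lo
    split_ifs <;> omega

theorem inner_sv_vec (r : Fin n ⊕ Fin n) (α : PosRoot n) : inner ℝ (sv r) α.vec =
    ((ip (wt r) (wt α.hi) + ip (wt r) (wt α.lo) : ℤ) : ℝ) := by
  simp only [PosRoot.vec_eq, inner_add_right, inner_sv]
  push_cast
  ring

/-- Pairing `α - β = γ` with signed unit vectors puts both indices of `α`, and the opposite of
`β.hi`, among the two indices of `γ`. By disjointness `β.hi` uses up one of them, so `α` is twice
the other; the coefficient 2 then needs both places for `α`. -/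
theorem PosRoot.sub_ne_vec {α β : PosRoot n} (h : ∀ r, α.Touches r → ¬ β.Touches r)
    (γ : PosRoot n) : α.vec - β.vec ≠ γ.vec := by
  intro hγ
  have key : ∀ r : Fin n ⊕ Fin n, (ip (wt r) (wt α.hi) + ip (wt r) (wt α.lo)) -
      (ip (wt r) (wt β.hi) + ip (wt r) (wt β.lo)) = ip (wt r) (wt γ.hi) + ip (wt r) (wt γ.lo) := by
    intro r
    have := congrArg (inner ℝ (sv r)) hγ
    rw [inner_sub_right, inner_sv_vec, inner_sv_vec, inner_sv_vec] at this
    exact_mod_cast this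
  have a1 := α.lo_le_hi
  have a2 := α.hi_add_lo
  have b1 := β.lo_le_hi
  have b2 := β.hi_add_lo
  have c1 := γ.lo_le_hi
  have c2 := γ.hi_add_lo
  have h1 := h α.hi (Or.inl rfl)
  have h2 := h α.lo (Or.inr (Or.inl rfl))
  simp only [Touches, not_or] at h1 h2
  have k1 := key α.hi
  have k2 := key α.lo
  have k3 := key β.hi
  generalize wt α.hi = ah, wt α.lo = al, wt β.hi = bh, wt β.lo = bl, wt γ.hi = ch,
    wt γ.lo = cl at *
  have z : ∀ a b : ℤ, a ≠ b → a ≠ - b → ip a b = 0 := fun a b h h' => by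
    rw [ip, if_neg h, if_neg h']
  have o : ∀ a : ℤ, ip a a = 1 := fun a => by simp [ip]
  have p : ∀ a b : ℤ, a ≠ - b → 0 ≤ ip a b := fun a b h => by
    rw [ip]; split_ifs <;> omega
  have q1 : ∀ a c d : ℤ, 1 ≤ ip a c + ip a d → a = c ∨ a = d := fun a c d h => by
    simp only [ip] at h; split_ifs at h <;> omega
  have q2 : ∀ a c d : ℤ, ip a c + ip a d ≤ -1 → a = - c ∨ a = - d := fun a c d h => by
    simp only [ip] at h; split_ifs at h <;> omega
  have q3 : ∀ a c d : ℤ, 2 ≤ ip a c + ip a d → a = c ∧ a = d := fun a c d h => by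
    simp only [ip] at h; split_ifs at h <;> omega
  rw [z ah bh (by omega) (by omega), z ah bl (by omega) (by omega), o] at k1
  rw [z al bh (by omega) (by omega), z al bl (by omega) (by omega), o] at k2
  rw [z bh ah (by omega) (by omega), z bh al (by omega) (by omega), o] at k3
  have e1 := q1 ah ch cl (by have := p ah al (by omega); omega)
  have e2 := q1 al ch cl (by have := p al ah (by omega); omega)
  have e3 := q2 bh ch cl (by have := p bh bl (by omega); omega)
  have e4 : al = ah := by omega
  rw [e4, o] at k1
  have e5 := q3 ah ch cl (by omega)
  omega

/-- On the indices it touches, the reflection in a root of `suppOf τ` agrees with `τ`. Two such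
roots touching a common index are therefore equal, and orthogonality and the condition on
differences follow from disjointness. For the product it remains to see that untouched indices are
fixed by `τ`. -/
theorem isSupport_suppOf {σ : weylGroup n} {τ : Fin n ⊕ Fin n → Fin n ⊕ Fin n}
    (hτ : ActsBy σ.1 τ) (hinv : ∀ r, τ (τ r) = r) : IsSupport σ (suppOf τ) := by
  have hdisj : ∀ α ∈ suppOf τ, ∀ β ∈ suppOf τ, α ≠ β → ∀ r, α.Touches r → ¬ β.Touches r :=
    fun α hα β hβ hne r h1 h2 => hne (PosRoot.eq_of_perm_eq h2
      ((perm_eq_of_mem_suppOf hτ.swap hinv hα h1).trans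
        (perm_eq_of_mem_suppOf hτ.swap hinv hβ h2).symm))
  refine ⟨fun α hα β hβ hne => PosRoot.inner_vec_eq_zero (hdisj α hα β hβ hne), ?_,
    fun α hα β hβ γ => ?_⟩
  · have hpw : (suppOf τ).toList.Pairwise fun α β => ∀ r, α.Touches r → ¬ β.Touches r :=
      (suppOf τ).nodup_toList.imp_of_mem fun {α β} hα hβ hne =>
        hdisj α (Finset.mem_toList.1 hα) β (Finset.mem_toList.1 hβ) hne
    refine ext_sv fun r => ?_
    have key := prod_refl_sv hpw r
    rw [hτ]
    by_cases hex : ∃ α ∈ suppOf τ, α.Touches r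
    · obtain ⟨α, hα, ht⟩ := hex
      rw [key.1 α (Finset.mem_toList.2 hα) ht, perm_eq_of_mem_suppOf hτ.swap hinv hα ht]
    · push Not at hex
      rw [key.2 fun α hα => hex α (Finset.mem_toList.1 hα)]
      congr 1
      by_contra hne
      rw [← wt_inj] at hne
      -- the root touching `r` is formed by the larger of `r`, `τ r` and the opposite of the other
      obtain ⟨s, hs, hlt⟩ : ∃ s, (s = r ∨ s = τ r) ∧ wt (τ s) < wt s := by
        rcases lt_or_gt_of_ne hne with h | h
        · exact ⟨τ r, Or.inr rfl, by rwa [hinv]⟩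
        · exact ⟨r, Or.inl rfl, h⟩
      have hts : ∀ α ∈ suppOf τ, ¬ α.Touches s := by
        rcases hs with rfl | rfl
        · exact hex
        · intro α hα ht
          refine hex α hα ?_
          rw [← hinv r, ← perm_eq_of_mem_suppOf hτ.swap hinv hα ht]
          exact PosRoot.touches_perm ht
      rcases le_total (wt (τ s).swap) (wt s) with hle | hle
      · obtain ⟨α, h1, h2⟩ := PosRoot.exists_hi_lo hle (by rw [wt_swap]; omega)
        exact hts α (mem_suppOf.2 (by rw [h1, h2, Sum.swap_swap])) (Or.inl (by rw [h1]))
      · obtain ⟨α, h1, h2⟩ := PosRoot.exists_hi_lo hle (by rw [wt_swap]; omega)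
        exact hts α (mem_suppOf.2 (by rw [h1, h2, hτ.swap, hinv]))
          (Or.inr (Or.inl (by rw [h2])))
  · by_cases hne : α = β
    · subst hne
      intro h
      rw [sub_self] at h
      have h2 := inner_sv_vec γ.hi γ
      rw [← h, inner_zero_right] at h2
      have h3 : ip (wt γ.hi) (wt γ.hi) + ip (wt γ.hi) (wt γ.lo) = 0 := by exact_mod_cast h2.symm
      have := γ.hi_add_lo
      simp only [ip] at h3
      split_ifs at h3 <;> omega
    · exact PosRoot.sub_ne_vec (hdisj α hα β hβ hne) γ

end Support

/-! ### The length function -/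

section Length

variable {n : ℕ}

/-- The sum of the weights of two signed indices. -/
def wtSum : Sym2 (Fin n ⊕ Fin n) → ℤ :=
  Sym2.lift ⟨fun r q => wt r + wt q, fun _ _ => add_comm _ _⟩

@[simp] theorem wtSum_mk (r q : Fin n ⊕ Fin n) : wtSum s(r, q) = wt r + wt q := rfl

/-- The positive roots, written as unordered pairs of signed indices from `A`, that `τ` makes
negative. -/
def inversions (A : Finset (Fin n ⊕ Fin n)) (τ : Fin n ⊕ Fin n → Fin n ⊕ Fin n) :
    Finset (Sym2 (Fin n ⊕ Fin n)) :=
  A.sym2.filter fun p => 0 < wtSum p ∧ wtSum (p.map τ) < 0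

theorem mem_inversions {A : Finset (Fin n ⊕ Fin n)} {τ : Fin n ⊕ Fin n → Fin n ⊕ Fin n}
    {r q : Fin n ⊕ Fin n} : s(r, q) ∈ inversions A τ ↔
      (r ∈ A ∧ q ∈ A) ∧ 0 < wt r + wt q ∧ wt (τ r) + wt (τ q) < 0 := by
  simp [inversions]

/-- A positive root as an unordered pair of signed indices. -/
def PosRoot.pair (α : PosRoot n) : Sym2 (Fin n ⊕ Fin n) := s(α.hi, α.lo)

/-- A fundamental reflection permutes the positive roots other than its own: its indices are
neighbours in the order, or `ε_n` twice, so no other sign can change. -/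
theorem IsFundamental.wtSum_map_pos {α : PosRoot n} (hα : IsFundamental α)
    {p : Sym2 (Fin n ⊕ Fin n)} (hp : 0 < wtSum p) (hne : p ≠ α.pair) :
    0 < wtSum (p.map α.perm) := by
  induction p using Sym2.ind with
  | _ r q =>
    have hne' : ¬ (wt r = wt α.hi ∧ wt q = wt α.lo) ∧ ¬ (wt r = wt α.lo ∧ wt q = wt α.hi) := by
      simpa [PosRoot.pair, wt_inj] using hne
    simp only [Sym2.map_mk, wtSum_mk] at hp ⊢
    have h1 := α.wt_perm r
    have h2 := α.wt_perm q
    have h3 := wt_ne_zero r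
    have h4 := wt_ne_zero q
    generalize wt (α.perm r) = x at *
    generalize wt (α.perm q) = y at *
    rcases hα with ⟨i, j, h, hij⟩ | ⟨i, hi⟩
    · have e1 : wt (PosRoot.sub i j h).hi = n - i := rfl
      have e2 : wt (PosRoot.sub i j h).lo = j - n := rfl
      split_ifs at h1 <;> split_ifs at h2 <;> omega
    · have e1 : wt (PosRoot.two i).hi = n - i := rfl
      have e2 : wt (PosRoot.two i).lo = n - i := rfl
      split_ifs at h1 <;> split_ifs at h2 <;> omega

theorem PosRoot.map_perm_map_perm (α : PosRoot n) (p : Sym2 (Fin n ⊕ Fin n)) :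
    (p.map α.perm).map α.perm = p := by
  rw [Sym2.map_map, show α.perm ∘ α.perm = id from funext α.perm_perm, Sym2.map_id, id]

theorem PosRoot.map_perm_pair_neg (α : PosRoot n) : wtSum (α.pair.map α.perm) < 0 := by
  have h1 := α.hi_add_lo
  have h2 := α.lo_le_hi
  have h3 := wt_ne_zero α.lo
  simp only [pair, Sym2.map_mk, wtSum_mk, wt_perm]
  split_ifs <;> omega

/-- The reflection itself is the bijection, since it permutes the positive roots different from `α`.
-/
theorem card_inversions_erase {α : PosRoot n} (hα : IsFundamental α)
    (τ : Fin n ⊕ Fin n → Fin n ⊕ Fin n) :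
    ((inversions Finset.univ (τ ∘ α.perm)).erase α.pair).card =
      ((inversions Finset.univ τ).erase α.pair).card := by
  have hstep : ∀ p, 0 < wtSum p → p ≠ α.pair →
      0 < wtSum (p.map α.perm) ∧ p.map α.perm ≠ α.pair := by
    intro p hp hne
    refine ⟨hα.wtSum_map_pos hp hne, fun h => ?_⟩
    have := α.map_perm_pair_neg
    rw [← h, α.map_perm_map_perm] at this
    omega
  refine Finset.card_nbij' (Sym2.map α.perm) (Sym2.map α.perm) ?_ ?_
    (fun p _ => α.map_perm_map_perm p) (fun p _ => α.map_perm_map_perm p)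
  · intro p hp
    simp only [inversions, Finset.coe_erase, Set.mem_sdiff, Finset.mem_coe, Finset.mem_filter,
      Finset.sym2_univ, Finset.mem_univ, true_and, Set.mem_singleton_iff] at hp ⊢
    obtain ⟨⟨h1, h2⟩, h3⟩ := hp
    rw [← Sym2.map_map] at h2
    exact ⟨⟨(hstep p h1 h3).1, h2⟩, (hstep p h1 h3).2⟩
  · intro p hp
    simp only [inversions, Finset.coe_erase, Set.mem_sdiff, Finset.mem_coe, Finset.mem_filter,
      Finset.sym2_univ, Finset.mem_univ, true_and, Set.mem_singleton_iff] at hp ⊢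
    obtain ⟨⟨h1, h2⟩, h3⟩ := hp
    rw [← Sym2.map_map, α.map_perm_map_perm]
    exact ⟨⟨(hstep p h1 h3).1, h2⟩, (hstep p h1 h3).2⟩

theorem pair_mem_inversions {α : PosRoot n} {τ : Fin n ⊕ Fin n → Fin n ⊕ Fin n} :
    α.pair ∈ inversions Finset.univ τ ↔ wt (τ α.hi) + wt (τ α.lo) < 0 := by
  simp [PosRoot.pair, mem_inversions, α.hi_add_lo]

/-- The reflection sends `α` to `-α`, so the sign of the image of `α` is reversed; that image is
never zero. -/
theorem pair_mem_inversions_comp {α : PosRoot n} {τ : Fin n ⊕ Fin n → Fin n ⊕ Fin n}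
    (hinj : Function.Injective τ) (hswap : ∀ r, τ r.swap = (τ r).swap) :
    α.pair ∈ inversions Finset.univ (τ ∘ α.perm) ↔ α.pair ∉ inversions Finset.univ τ := by
  have e1 : α.perm α.hi = α.lo.swap := by rw [PosRoot.perm, if_pos rfl]
  have e2 : α.perm α.lo = α.hi.swap := by
    rw [PosRoot.perm]
    split_ifs with h
    · rw [h]
    · rfl
    all_goals exact absurd rfl ‹_›
  rw [pair_mem_inversions, pair_mem_inversions]
  simp only [Function.comp_apply, e1, e2, hswap, wt_swap]
  have h : wt (τ α.hi) + wt (τ α.lo) ≠ 0 := by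
    intro h
    have h1 : τ α.hi = τ α.lo.swap := by
      rw [← wt_inj, hswap, wt_swap]; omega
    have h2 := congrArg wt (hinj h1)
    rw [wt_swap] at h2
    have := α.hi_add_lo
    omega
  omega

theorem exists_inversions_le (L : List (PosRoot n)) (hL : ∀ α ∈ L, IsFundamental α) :
    ∃ τ, ActsBy (L.map PosRoot.refl).prod τ ∧ (inversions Finset.univ τ).card ≤ L.length := by
  induction L using List.reverseRecOn with
  | nil =>
    refine ⟨id, actsBy_one, ?_⟩
    rw [List.length_nil, Nat.le_zero, Finset.card_eq_zero, Finset.eq_empty_iff_forall_notMem]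
    intro p
    induction p using Sym2.ind with
    | _ r q =>
      rw [mem_inversions]
      simp only [id]
      omega
  | append_singleton L α ih =>
    obtain ⟨τ, hτ, hle⟩ := ih fun β hβ => hL β (List.mem_append_left _ hβ)
    refine ⟨τ ∘ α.perm, ?_, ?_⟩
    · rw [List.map_append, List.prod_append, List.map_singleton, List.prod_singleton]
      exact hτ.mul α.refl_sv
    · have h := card_inversions_erase (hL α (by simp)) τ
      have h1 := Finset.card_erase_le (s := inversions Finset.univ τ) (a := α.pair)
      have h2 := Finset.pred_card_le_card_erase (s := inversions Finset.univ (τ ∘ α.perm))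
        (a := α.pair)
      rw [List.length_append, List.length_singleton]
      omega

/-- Without an inverted fundamental root, the weights of the images of `ε_1, …, ε_n` decrease
strictly and stay positive. Being at most `n`, they are `n, …, 1`: induction from the first index
bounds them above, induction from the last one below. -/
theorem eq_id_of_forall_fundamental {w : EuclideanSpace ℝ (Fin n) ≃ₗᵢ[ℝ] EuclideanSpace ℝ (Fin n)}
    {τ : Fin n ⊕ Fin n → Fin n ⊕ Fin n} (hτ : ActsBy w τ)
    (h : ∀ α, IsFundamental α → α.pair ∉ inversions Finset.univ τ) : τ = id := by
  have hfix : ∀ i : Fin n, wt (τ (.inr i)) = n - i := by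
    intro i
    apply le_antisymm
    · obtain ⟨i, hi⟩ := i
      induction i with
      | zero => simpa using wt_le _
      | succ k ih =>
        have h1 := h _ (IsFundamental.sub ⟨k, by omega⟩ ⟨k + 1, hi⟩ (by simp) rfl)
        -- Passing to the reflected permutation turns the failure of `< 0` into a strict inequality
        -- the other way.
        rw [← pair_mem_inversions_comp hτ.injective hτ.swap, pair_mem_inversions] at h1
        have h2 := ih (by omega)
        simp [PosRoot.perm, PosRoot.hi, PosRoot.lo] at h1 h2 ⊢
        have h3 := hτ.swap (.inr ⟨k, by omega⟩)
        simp at h3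
        rw [h3, wt_swap] at h1
        omega
    · obtain ⟨k, hk⟩ : ∃ k, (i : ℕ) + 1 + k = n := ⟨n - (i + 1), by omega⟩
      induction k generalizing i with
      | zero =>
        have h1 := h _ (IsFundamental.two i (by omega))
        rw [pair_mem_inversions] at h1
        have := wt_ne_zero (τ (.inr i))
        simp only [PosRoot.hi, PosRoot.lo] at h1
        omega
      | succ k ih =>
        have h1 := h _ (IsFundamental.sub i ⟨i + 1, by omega⟩ (Fin.mk_lt_mk.2 (by omega)) rfl)
        have h2 := ih ⟨i + 1, by omega⟩ (by simp only; omega)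
        rw [pair_mem_inversions] at h1
        simp only [PosRoot.hi, PosRoot.lo] at h1 h2
        have h3 := hτ.swap (.inr ⟨i + 1, by omega⟩)
        rw [Sum.swap_inr] at h3
        have h4 : wt (τ (.inr i)) ≠ wt (τ (.inr ⟨i + 1, by omega⟩)) := fun h => by
          have := hτ.injective (wt_injective h)
          simp [Fin.ext_iff] at this
        rw [h3, wt_swap] at h1
        omega
  funext r
  rcases r with i | i
  · have h3 := hτ.swap (.inr i)
    rw [Sum.swap_inr] at h3
    rw [← wt_inj, h3, wt_swap, hfix]
    simp [wt]
  · rw [← wt_inj, hfix]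
    rfl

/-- As long as some fundamental root is inverted, multiplying by its reflection on the right removes
exactly one inversion. -/
theorem exists_word {w : EuclideanSpace ℝ (Fin n) ≃ₗᵢ[ℝ] EuclideanSpace ℝ (Fin n)}
    {τ : Fin n ⊕ Fin n → Fin n ⊕ Fin n} (hτ : ActsBy w τ) :
    ∃ L : List (PosRoot n), (∀ α ∈ L, IsFundamental α) ∧ (L.map PosRoot.refl).prod = w ∧
      L.length ≤ (inversions Finset.univ τ).card := by
  induction hk : (inversions Finset.univ τ).card using Nat.strong_induction_on generalizing w τ with
  | _ k ih =>
  by_cases h : ∃ α, IsFundamental α ∧ α.pair ∈ inversions Finset.univ τ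
  · obtain ⟨α, hα, hmem⟩ := h
    have h1 := card_inversions_erase hα τ
    rw [Finset.erase_eq_of_notMem (fun h => (pair_mem_inversions_comp hτ.injective hτ.swap).1 h hmem),
      Finset.card_erase_of_mem hmem] at h1
    have hpos := Finset.card_pos.2 ⟨_, hmem⟩
    obtain ⟨L, hL, hprod, hlen⟩ := ih _ (by omega) (hτ.mul α.refl_sv) rfl
    refine ⟨L ++ [α], ?_, ?_, ?_⟩
    · intro β hβ
      rcases List.mem_append.1 hβ with hβ | hβ
      · exact hL β hβ
      · rwa [List.mem_singleton.1 hβ]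
    · rw [List.map_append, List.prod_append, List.map_singleton, List.prod_singleton, hprod]
      refine ext_sv fun r => ?_
      simp only [LinearIsometryEquiv.coe_mul, Function.comp_apply, PosRoot.refl_sv, α.perm_perm]
    · rw [List.length_append, List.length_singleton]
      omega
  · push Not at h
    have hid := eq_id_of_forall_fundamental hτ h
    subst hid
    refine ⟨[], by simp, ?_, by simp⟩
    refine ext_sv fun r => ?_
    rw [hτ]
    rfl

theorem length_eq_card_inversions {w : weylGroup n} {τ : Fin n ⊕ Fin n → Fin n ⊕ Fin n}
    (hτ : ActsBy w.1 τ) : length w = (inversions Finset.univ τ).card := by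
  obtain ⟨L, hL, hprod, hlen⟩ := exists_word hτ
  apply le_antisymm
  · exact (show length w ≤ L.length from Nat.sInf_le ⟨L, hL, hprod, rfl⟩).trans hlen
  · refine le_csInf ⟨_, L, hL, hprod, rfl⟩ ?_
    rintro _ ⟨L', hL', hprod', rfl⟩
    obtain ⟨τ', hτ', hle⟩ := exists_inversions_le L' hL'
    have : τ' = τ := funext fun r => sv_injective (by rw [← hτ', ← hτ, hprod'])
    rwa [← this]

end Length

/-! ### Symplectic matrices in signed coordinates -/

section Symplectic

variable {n : ℕ}

/-- The sign of a signed index. -/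
def sgn : Fin n ⊕ Fin n → ℂ
  | .inl _ => -1
  | .inr _ => 1

@[simp] theorem sgn_swap (r : Fin n ⊕ Fin n) : sgn r.swap = - sgn r := by
  rcases r with i | i <;> simp [sgn]

@[simp] theorem sgn_mul_sgn (r : Fin n ⊕ Fin n) : sgn r * sgn r = 1 := by
  rcases r with i | i <;> simp [sgn]

theorem sgn_ne_zero (r : Fin n ⊕ Fin n) : sgn r ≠ 0 := by
  rcases r with i | i <;> simp [sgn]

theorem swap_ne (r : Fin n ⊕ Fin n) : r.swap ≠ r := by
  rcases r with i | i <;> simp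

theorem swap_eq_iff {r q : Fin n ⊕ Fin n} : r.swap = q ↔ r = q.swap := by
  constructor <;> rintro rfl <;> simp

theorem J_apply (r q : Fin n ⊕ Fin n) :
    Matrix.J (Fin n) ℂ r q = if r = q.swap then sgn r else 0 := by
  rcases r with i | i <;> rcases q with j | j <;>
    simp [Matrix.J, sgn, Matrix.one_apply, apply_ite]

theorem mul_J_apply (g : Matrix (Fin n ⊕ Fin n) (Fin n ⊕ Fin n) ℂ) (r q : Fin n ⊕ Fin n) :
    (g * Matrix.J (Fin n) ℂ) r q = - (g r q.swap * sgn q) := by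
  simp [Matrix.mul_apply, J_apply]

theorem J_mul_apply (g : Matrix (Fin n ⊕ Fin n) (Fin n ⊕ Fin n) ℂ) (r q : Fin n ⊕ Fin n) :
    (Matrix.J (Fin n) ℂ * g) r q = sgn r * g r.swap q := by
  simp only [Matrix.mul_apply, J_apply, ← swap_eq_iff]
  simp

theorem mem_symplectic_iff {g : Matrix (Fin n ⊕ Fin n) (Fin n ⊕ Fin n) ℂ} :
    g ∈ Matrix.symplecticGroup (Fin n) ℂ ↔
      ∀ r q, ∑ b, g r b * sgn b * g q b.swap = if r = q.swap then sgn r else 0 := by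
  rw [SymplecticGroup.mem_iff, ← Matrix.ext_iff]
  refine forall_congr' fun r => forall_congr' fun q => ?_
  rw [J_apply, mul_assoc, Matrix.mul_apply]
  simp only [J_mul_apply, Matrix.transpose_apply, mul_assoc]

theorem sum_col_of_symplectic {g : Matrix (Fin n ⊕ Fin n) (Fin n ⊕ Fin n) ℂ}
    (hg : g ∈ Matrix.symplecticGroup (Fin n) ℂ) (r q : Fin n ⊕ Fin n) :
    ∑ b, g b r * sgn b * g b.swap q = if r = q.swap then sgn r else 0 := by
  simpa using mem_symplectic_iff.1 (SymplecticGroup.transpose_mem hg) r q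

theorem conj_apply (g M : Matrix (Fin n ⊕ Fin n) (Fin n ⊕ Fin n) ℂ) (r q : Fin n ⊕ Fin n) :
    (g * M * gᵀ) r q = ∑ x, ∑ y, g r x * M x y * g q y := by
  simp only [Matrix.mul_apply, Matrix.transpose_apply, Finset.sum_mul]
  rw [Finset.sum_comm]

/-- The matrices of `B` that differ from the unit matrix only in rows and columns from `A`. -/
structure IsBorelOn (A : Finset (Fin n ⊕ Fin n))
    (g : Matrix (Fin n ⊕ Fin n) (Fin n ⊕ Fin n) ℂ) : Prop where
  upper : ∀ r q, wt q < wt r → g r q = 0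
  symplectic : g ∈ Matrix.symplecticGroup (Fin n) ℂ
  outside : ∀ r q, r ∉ A ∨ q ∉ A → g r q = if r = q then 1 else 0

variable {A A' : Finset (Fin n ⊕ Fin n)} {g h : Matrix (Fin n ⊕ Fin n) (Fin n ⊕ Fin n) ℂ}

theorem IsBorelOn.mono (hg : IsBorelOn A' g) (h : A' ⊆ A) : IsBorelOn A g :=
  ⟨hg.upper, hg.symplectic, fun r q hrq => hg.outside r q
    (hrq.imp (fun h1 h2 => h1 (h h2)) fun h1 h2 => h1 (h h2))⟩

theorem IsBorelOn.mul (hg : IsBorelOn A g) (hh : IsBorelOn A h) : IsBorelOn A (g * h) := by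
  refine ⟨fun r q hrq => ?_, mul_mem hg.symplectic hh.symplectic, fun r q hrq => ?_⟩
  · rw [Matrix.mul_apply]
    refine Finset.sum_eq_zero fun x _ => ?_
    rcases lt_or_ge (wt x) (wt r) with hx | hx
    · rw [hg.upper r x hx, zero_mul]
    · rw [hh.upper x q (by omega), mul_zero]
  · rw [Matrix.mul_apply]
    rcases hrq with hr | hq
    · simp [hg.outside r _ (Or.inl hr), hh.outside r q (Or.inl hr)]
    · simp [hh.outside _ q (Or.inr hq), hg.outside r q (Or.inr hq)]

theorem IsBorelOn.diag_mul (hg : IsBorelOn A g) (r : Fin n ⊕ Fin n) :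
    g r r * g r.swap r.swap = 1 := by
  have h := mem_symplectic_iff.1 hg.symplectic r r.swap
  rw [Finset.sum_eq_single r, Sum.swap_swap, if_pos rfl] at h
  · have := sgn_ne_zero r
    have h2 : sgn r * (g r r * g r.swap r.swap) = sgn r * 1 := by linear_combination h
    exact mul_left_cancel₀ this h2
  · intro b _ hb
    rcases lt_trichotomy (wt b) (wt r) with h | h | h
    · rw [hg.upper r b h, zero_mul, zero_mul]
    · exact absurd (wt_injective h) hb
    · rw [hg.upper r.swap b.swap (by simpa using h), mul_zero]
  · simp

theorem IsBorelOn.diag_ne_zero (hg : IsBorelOn A g) (r : Fin n ⊕ Fin n) : g r r ≠ 0 :=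
  left_ne_zero_of_mul (by rw [hg.diag_mul r]; exact one_ne_zero)

/-- The matrix `g` with its rows and columns outside `A` replaced by those of the unit matrix. -/
def restr (A : Finset (Fin n ⊕ Fin n)) (g : Matrix (Fin n ⊕ Fin n) (Fin n ⊕ Fin n) ℂ) :
    Matrix (Fin n ⊕ Fin n) (Fin n ⊕ Fin n) ℂ :=
  fun r q => if r ∈ A ∧ q ∈ A then g r q else if r = q then 1 else 0

theorem restr_eq_self (hg : IsBorelOn A g) : restr A g = g := by
  ext r q
  simp only [restr]
  split_ifs with h1 h2
  · rfl
  · rw [hg.outside r q (by tauto), if_pos h2]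
  · rw [hg.outside r q (by tauto), if_neg h2]

/-- The symplectic relation between two retained rows is a sum over `b` of products of entries in
the columns `b` and `-b`. The hypothesis `hcol` kills the terms at deleted `b`, so the relation
survives the deletion. -/
theorem isBorelOn_restr (hg : IsBorelOn A g) (hA : ∀ r ∈ A', r.swap ∈ A')
    (hcol : ∀ b ∉ A', (∀ r ∈ A', g r b = 0) ∨ ∀ r ∈ A', g r b.swap = 0) :
    IsBorelOn A' (restr A' g) := by
  have hA' : ∀ r, r.swap ∈ A' ↔ r ∈ A' := fun r =>
    ⟨fun h => by simpa using hA _ h, hA r⟩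
  have hout : ∀ r q, r ∉ A' ∨ q ∉ A' → restr A' g r q = if r = q then 1 else 0 := by
    intro r q h
    rw [restr, if_neg (by tauto)]
  refine ⟨fun r q hrq => ?_, ?_, hout⟩
  · have hne : r ≠ q := fun h => by subst h; exact lt_irrefl _ hrq
    simp only [restr, if_neg hne, hg.upper r q hrq, ite_self]
  · rw [mem_symplectic_iff]
    intro r q
    by_cases hr : r ∈ A'
    · by_cases hq : q ∈ A'
      · rw [← mem_symplectic_iff.1 hg.symplectic r q]
        refine Finset.sum_congr rfl fun b _ => ?_
        by_cases hb : b ∈ A'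
        · simp [restr, hr, hq, hb, hA']
        · have hne : r ≠ b := fun h => hb (h ▸ hr)
          rw [hout r b (Or.inr hb), if_neg hne]
          rcases hcol b hb with h | h
          · rw [h r hr]; ring
          · rw [h q hq]; ring
      · rw [Finset.sum_eq_single q.swap]
        · have hne : r ≠ q.swap := fun h => hq ((hA' q).1 (h ▸ hr))
          rw [hout r q.swap (Or.inr (by rwa [hA'])), if_neg hne, if_neg hne]; ring
        · intro b _ hb
          rw [hout q b.swap (Or.inl hq), if_neg (fun h => hb (swap_eq_iff.1 h.symm)), mul_zero]
        · simp
    · rw [Finset.sum_eq_single r]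
      · rw [hout r r (Or.inl hr), if_pos rfl, hout q r.swap (Or.inr (by rwa [hA']))]
        by_cases h : r = q.swap
        · subst h; simp
        · rw [if_neg h, if_neg (fun h' => h (swap_eq_iff.1 h'.symm)), mul_zero]
      · intro b _ hb
        rw [hout r b (Or.inl hr), if_neg (fun h => hb h.symm), zero_mul, zero_mul]
      · simp

/-- The nilpotent symplectic matrix with the column `v` at `b` and the matching row at `-b`. -/
def nilp (b : Fin n ⊕ Fin n) (v : Fin n ⊕ Fin n → ℂ) :
    Matrix (Fin n ⊕ Fin n) (Fin n ⊕ Fin n) ℂ :=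
  fun r q => (if q = b then v r else 0) + if r = b.swap then sgn b * sgn q * v q.swap else 0

theorem nilp_neg (b : Fin n ⊕ Fin n) (v : Fin n ⊕ Fin n → ℂ) :
    nilp b (fun r => - v r) = - nilp b v := by
  ext r q
  simp only [nilp, Matrix.neg_apply]
  split_ifs <;> ring

theorem sum_sgn_mul_swap (v : Fin n ⊕ Fin n → ℂ) : ∑ x, sgn x * v x.swap * v x = 0 := by
  have h : ∑ x, sgn x * v x.swap * v x = ∑ x, - (sgn x * v x.swap * v x) := by
    rw [← Equiv.sum_comp (Equiv.sumComm (Fin n) (Fin n))]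
    refine Finset.sum_congr rfl fun x _ => ?_
    simp only [Equiv.sumComm_apply, sgn_swap, Sum.swap_swap]
    ring
  rw [Finset.sum_neg_distrib] at h
  exact CharZero.eq_neg_self_iff.1 h

/-- The row `b` is zero because `v b = 0`, and the row at `-b` is the symplectic product with `v`,
which kills `v` itself. -/
theorem nilp_mul_nilp {b : Fin n ⊕ Fin n} {v : Fin n ⊕ Fin n → ℂ} (hv : v b = 0) :
    nilp b v * nilp b v = 0 := by
  have hb : ∀ q, nilp b v b q = 0 := fun q => by
    simp [nilp, hv, (swap_ne b).symm]
  ext r q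
  rw [Matrix.mul_apply, Matrix.zero_apply]
  have h1 : ∀ x, nilp b v r x * nilp b v x q = (if x = b then v r * nilp b v x q else 0) +
      (if r = b.swap then sgn b else 0) * (sgn x * v x.swap * nilp b v x q) := by
    intro x
    generalize hz : nilp b v x q = z
    simp only [nilp]
    split_ifs <;> ring
  have h2 : ∑ x, sgn x * v x.swap * nilp b v x q = 0 := by
    simp only [nilp, mul_add, mul_ite, mul_zero, Finset.sum_add_distrib, Finset.sum_ite_eq',
      Finset.mem_univ, if_true, Sum.swap_swap, hv, zero_mul, add_zero]
    split_ifs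
    · exact sum_sgn_mul_swap v
    · simp
  simp only [h1, Finset.sum_add_distrib, ← Finset.mul_sum, h2, Finset.sum_ite_eq',
    Finset.mem_univ, if_true, hb, mul_zero, add_zero]

theorem nilp_mul_J (b : Fin n ⊕ Fin n) (v : Fin n ⊕ Fin n → ℂ) :
    nilp b v * Matrix.J (Fin n) ℂ = - (Matrix.J (Fin n) ℂ * (nilp b v)ᵀ) := by
  ext r q
  rw [mul_J_apply, Matrix.neg_apply, J_mul_apply, Matrix.transpose_apply]
  simp only [nilp, swap_eq_iff, sgn_swap, Sum.swap_swap]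
  have h1 := sgn_mul_sgn q
  have h2 := sgn_mul_sgn r
  by_cases hr : r = b.swap <;> by_cases hq : q = b.swap
  · subst hr; subst hq; simp; ring
  · subst hr; simp only [hq, if_true, if_false, sgn_swap]; linear_combination (v q * sgn b) * h1
  · subst hq; simp only [hr, if_true, if_false, sgn_swap]; linear_combination (-v r * sgn b) * h2
  · simp [hr, hq]

/-- The elementary unipotent matrix with the column `v` at `b`. -/
def elem (b : Fin n ⊕ Fin n) (v : Fin n ⊕ Fin n → ℂ) :
    Matrix (Fin n ⊕ Fin n) (Fin n ⊕ Fin n) ℂ := 1 + nilp b v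

theorem elem_mul_elem_neg {b : Fin n ⊕ Fin n} {v : Fin n ⊕ Fin n → ℂ} (hv : v b = 0) :
    elem b v * elem b (fun r => - v r) = 1 := by
  rw [elem, elem, nilp_neg]
  have := nilp_mul_nilp hv
  simp only [mul_add, add_mul, mul_one, one_mul, mul_neg, this]
  abel

/-- With `N = nilp b v`, the relations `N J = -J Nᵀ` and `N² = 0` remove the linear and the
quadratic terms of `(1 + N) J (1 + N)ᵀ`. -/
theorem elem_mem {b : Fin n ⊕ Fin n} {v : Fin n ⊕ Fin n → ℂ} (hv : v b = 0) :
    elem b v ∈ Matrix.symplecticGroup (Fin n) ℂ := by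
  rw [SymplecticGroup.mem_iff, elem]
  have h1 := nilp_mul_J b v
  have h2 := nilp_mul_nilp hv
  have h3 : nilp b v * (Matrix.J (Fin n) ℂ * (nilp b v)ᵀ) = 0 := by
    rw [← neg_neg (Matrix.J (Fin n) ℂ * (nilp b v)ᵀ), ← h1, mul_neg, ← mul_assoc, h2, zero_mul,
      neg_zero]
  rw [Matrix.transpose_add, Matrix.transpose_one]
  simp only [add_mul, mul_add, mul_one, one_mul, mul_assoc, h3]
  rw [h1]
  abel

theorem isBorelOn_elem {b : Fin n ⊕ Fin n} {v : Fin n ⊕ Fin n → ℂ} (hA : ∀ r ∈ A, r.swap ∈ A)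
    (hb : b ∈ A) (hv : ∀ r, v r ≠ 0 → r ∈ A ∧ wt r < wt b) : IsBorelOn A (elem b v) := by
  have hvb : v b = 0 := by
    by_contra h
    exact lt_irrefl _ (hv b h).2
  refine ⟨fun r q hrq => ?_, elem_mem hvb, fun r q hrq => ?_⟩
  · have hne : r ≠ q := fun h => by subst h; exact lt_irrefl _ hrq
    have h1 : q = b → v r = 0 := by
      rintro rfl
      by_contra h
      have := (hv r h).2
      omega
    have h2 : r = b.swap → v q.swap = 0 := by
      rintro rfl
      by_contra h
      have := (hv _ h).2
      rw [wt_swap] at this hrq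
      omega
    simp only [elem, nilp, Matrix.add_apply, Matrix.one_apply_ne hne]
    have e1 : (if q = b then v r else 0) = 0 := by split_ifs with h; exacts [h1 h, rfl]
    have e2 : (if r = b.swap then sgn b * sgn q * v q.swap else 0) = 0 := by
      split_ifs with h
      exacts [by rw [h2 h, mul_zero], rfl]
    rw [e1, e2, add_zero, add_zero]
  · have h1 : q = b → v r = 0 := by
      rintro rfl
      by_contra h
      have := (hv r h).1
      tauto
    have h2 : r = b.swap → v q.swap = 0 := by
      rintro rfl
      by_contra h
      have := hA _ (hv _ h).1
      have := hA _ hb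
      rw [Sum.swap_swap] at *
      tauto
    simp only [elem, nilp, Matrix.add_apply, Matrix.one_apply]
    have e1 : (if q = b then v r else 0) = 0 := by split_ifs with h; exacts [h1 h, rfl]
    have e2 : (if r = b.swap then sgn b * sgn q * v q.swap else 0) = 0 := by
      split_ifs with h
      exacts [by rw [h2 h, mul_zero], rfl]
    rw [e1, e2, add_zero, add_zero]

end Symplectic

/-! ### Orbits of symmetric forms -/

section Forms

variable {n : ℕ}

/-- The part of a matrix strictly below the antidiagonal. -/
def trunc (M : Matrix (Fin n ⊕ Fin n) (Fin n ⊕ Fin n) ℂ) :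
    Matrix (Fin n ⊕ Fin n) (Fin n ⊕ Fin n) ℂ :=
  fun r q => if 0 < wt r + wt q then M r q else 0

theorem trunc_apply {M : Matrix (Fin n ⊕ Fin n) (Fin n ⊕ Fin n) ℂ} {r q : Fin n ⊕ Fin n}
    (h : 0 < wt r + wt q) : trunc M r q = M r q := if_pos h

/-- For upper triangular `g` only entries `(x, y)` with `wt x ≥ wt r` and `wt y ≥ wt q` contribute
to the entry `(r, q)`. The action therefore descends to truncated matrices, which are the model of
the dual space. -/
theorem trunc_conj {A : Finset (Fin n ⊕ Fin n)} {g : Matrix (Fin n ⊕ Fin n) (Fin n ⊕ Fin n) ℂ}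
    (hg : IsBorelOn A g) (M : Matrix (Fin n ⊕ Fin n) (Fin n ⊕ Fin n) ℂ) :
    trunc (g * trunc M * gᵀ) = trunc (g * M * gᵀ) := by
  ext r q
  simp only [trunc]
  split_ifs with h
  · rw [conj_apply, conj_apply]
    refine Finset.sum_congr rfl fun x _ => Finset.sum_congr rfl fun y _ => ?_
    rcases lt_or_ge (wt x) (wt r) with hx | hx
    · rw [hg.upper r x hx]; ring
    rcases lt_or_ge (wt y) (wt q) with hy | hy
    · rw [hg.upper q y hy]; ring
    rw [trunc_apply (by omega)]
  · rfl

/-- A symmetric form `Q` whose nonzero entries are given by an involution `τ` of the signed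
indices from `A`. -/
structure IsDatum (A : Finset (Fin n ⊕ Fin n)) (τ : Fin n ⊕ Fin n → Fin n ⊕ Fin n)
    (Q : Matrix (Fin n ⊕ Fin n) (Fin n ⊕ Fin n) ℂ) : Prop where
  symm : ∀ r ∈ A, r.swap ∈ A
  map_mem : ∀ r ∈ A, τ r ∈ A
  map_swap : ∀ r, τ r.swap = (τ r).swap
  map_map : ∀ r, τ (τ r) = r
  form_symm : ∀ r q, Q r q = Q q r
  form_ne_zero : ∀ r q, Q r q ≠ 0 ↔ r ∈ A ∧ q = (τ r).swap ∧ wt (τ r) < wt r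

/-- The coordinates of the points of the orbit of `Q`. -/
def orbitFamily (A : Finset (Fin n ⊕ Fin n)) (Q : Matrix (Fin n ⊕ Fin n) (Fin n ⊕ Fin n) ℂ)
    (g : {g // IsBorelOn A g}) (p : (Fin n ⊕ Fin n) × (Fin n ⊕ Fin n)) : ℂ :=
  trunc (g.1 * Q * g.1ᵀ) p.1 p.2

/-- The largest index `a` from `A` together with its partner `m`. -/
structure IsTop (A : Finset (Fin n ⊕ Fin n)) (τ : Fin n ⊕ Fin n → Fin n ⊕ Fin n)
    (Q : Matrix (Fin n ⊕ Fin n) (Fin n ⊕ Fin n) ℂ) (a m : Fin n ⊕ Fin n) : Prop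
    extends IsDatum A τ Q where
  mem : a ∈ A
  le : ∀ r ∈ A, wt r ≤ wt a
  map_top : τ a = m.swap

/-- The indices from `A` other than `±a`, `±m`. -/
def core (A : Finset (Fin n ⊕ Fin n)) (a m : Fin n ⊕ Fin n) : Finset (Fin n ⊕ Fin n) :=
  A.filter fun r => r ≠ a ∧ r ≠ a.swap ∧ r ≠ m ∧ r ≠ m.swap

/-- The part of `Q` with indices from `core A a m`. -/
def coreForm (A : Finset (Fin n ⊕ Fin n)) (a m : Fin n ⊕ Fin n)
    (Q : Matrix (Fin n ⊕ Fin n) (Fin n ⊕ Fin n) ℂ) :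
    Matrix (Fin n ⊕ Fin n) (Fin n ⊕ Fin n) ℂ :=
  fun r q => if r ∈ core A a m then Q r q else 0

variable {A : Finset (Fin n ⊕ Fin n)} {τ : Fin n ⊕ Fin n → Fin n ⊕ Fin n}
  {Q g : Matrix (Fin n ⊕ Fin n) (Fin n ⊕ Fin n) ℂ} {a m : Fin n ⊕ Fin n}

theorem mem_core {r : Fin n ⊕ Fin n} :
    r ∈ core A a m ↔ r ∈ A ∧ r ≠ a ∧ r ≠ a.swap ∧ r ≠ m ∧ r ≠ m.swap := by simp [core]

theorem core_subset : core A a m ⊆ A := Finset.filter_subset _ _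

theorem IsDatum.conj_symm (hD : IsDatum A τ Q) (r q : Fin n ⊕ Fin n) :
    (g * Q * gᵀ) r q = (g * Q * gᵀ) q r := by
  rw [conj_apply, conj_apply, Finset.sum_comm]
  refine Finset.sum_congr rfl fun x _ => Finset.sum_congr rfl fun y _ => ?_
  rw [hD.form_symm]; ring

theorem IsDatum.conj_eq_zero_of_notMem (hD : IsDatum A τ Q) (hg : IsBorelOn A g)
    {r q : Fin n ⊕ Fin n} (hr : r ∉ A) : (g * Q * gᵀ) r q = 0 := by
  rw [conj_apply]
  refine Finset.sum_eq_zero fun x _ => Finset.sum_eq_zero fun y _ => ?_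
  by_cases h : Q x y = 0
  · rw [h]; ring
  · have hx := ((hD.form_ne_zero x y).1 h).1
    rw [hg.outside r x (Or.inl hr), if_neg (fun h : r = x => hr (h ▸ hx))]; ring

namespace IsTop

variable (hT : IsTop A τ Q a m)

include hT

theorem partner_mem : m ∈ A := by
  have := hT.symm _ (hT.map_mem a hT.mem)
  rwa [hT.map_top, Sum.swap_swap] at this

theorem neg_le {r : Fin n ⊕ Fin n} (hr : r ∈ A) : - wt a ≤ wt r := by
  have := hT.le _ (hT.symm r hr)
  rw [wt_swap] at this
  omega

theorem map_partner : τ m = a.swap := by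
  have := hT.map_map a
  rw [hT.map_top, hT.map_swap] at this
  rw [← this, Sum.swap_swap]

theorem map_mem_core {r : Fin n ⊕ Fin n} (hr : r ∈ core A a m) : τ r ∈ core A a m := by
  rw [mem_core] at hr ⊢
  obtain ⟨h0, h1, h2, h3, h4⟩ := hr
  refine ⟨hT.map_mem r h0, ?_, ?_, ?_, ?_⟩ <;> intro h <;> have h' := congrArg τ h <;>
    rw [hT.map_map] at h'
  · rw [hT.map_top] at h'; exact h4 h'
  · rw [hT.map_swap, hT.map_top, Sum.swap_swap] at h'; exact h3 h'
  · rw [hT.map_partner] at h'; exact h2 h'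
  · rw [hT.map_swap, hT.map_partner, Sum.swap_swap] at h'; exact h1 h'

theorem core_symm {r : Fin n ⊕ Fin n} (hr : r ∈ core A a m) : r.swap ∈ core A a m := by
  rw [mem_core] at hr ⊢
  obtain ⟨h0, h1, h2, h3, h4⟩ := hr
  simp only [ne_eq, swap_eq_iff, Sum.swap_swap]
  exact ⟨hT.symm r h0, h2, h1, h4, h3⟩

theorem form_cases {x y : Fin n ⊕ Fin n} (h : Q x y ≠ 0) :
    (x ∈ core A a m ∧ y ∈ core A a m) ∨ (x = a ∧ y = m) ∨ (x = m ∧ y = a) := by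
  obtain ⟨hx, rfl, hlt⟩ := (hT.form_ne_zero x y).1 h
  by_cases h1 : x = a
  · subst h1
    rw [hT.map_top, Sum.swap_swap]
    exact Or.inr (Or.inl ⟨rfl, rfl⟩)
  by_cases h3 : x = m
  · subst h3
    rw [hT.map_partner, Sum.swap_swap]
    exact Or.inr (Or.inr ⟨rfl, rfl⟩)
  have h2 : x ≠ a.swap := by
    rintro rfl
    have := hT.neg_le (hT.map_mem _ hx)
    rw [wt_swap] at hlt
    omega
  have h4 : x ≠ m.swap := by
    rintro rfl
    rw [hT.map_swap, hT.map_partner, Sum.swap_swap] at hlt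
    have := hT.le _ hx
    omega
  have hc : x ∈ core A a m := mem_core.2 ⟨hx, h1, h2, h3, h4⟩
  exact Or.inl ⟨hc, hT.core_symm (hT.map_mem_core hc)⟩

/-- Restricting the row index is enough: `τ` and the change of sign preserve the core, so a nonzero
entry in a core row also lies in a core column. -/
theorem core_isDatum : IsDatum (core A a m) τ (coreForm A a m Q) := by
  refine ⟨fun r => hT.core_symm, fun r => hT.map_mem_core, hT.map_swap, hT.map_map, ?_, ?_⟩
  · have key : ∀ r q, r ∈ core A a m → coreForm A a m Q r q = coreForm A a m Q q r := by
      intro r q hr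
      by_cases h : Q r q = 0
      · rw [coreForm, if_pos hr, coreForm, ← hT.form_symm r q, h, ite_self]
      · have hq : q ∈ core A a m := by
          obtain ⟨_, rfl, _⟩ := (hT.form_ne_zero r q).1 h
          exact hT.core_symm (hT.map_mem_core hr)
        rw [coreForm, coreForm, if_pos hr, if_pos hq, hT.form_symm]
    intro r q
    by_cases hr : r ∈ core A a m
    · exact key r q hr
    by_cases hq : q ∈ core A a m
    · exact (key q r hq).symm
    rw [coreForm, coreForm, if_neg hr, if_neg hq]
  · intro r q
    rw [coreForm]
    split_ifs with h
    · rw [hT.form_ne_zero]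
      simp [h, core_subset h]
    · simp [h]

theorem row_top (hg : IsBorelOn A g) {x : Fin n ⊕ Fin n} (hx : x ≠ a) : g a x = 0 := by
  rcases lt_or_ge (wt x) (wt a) with h | h
  · exact hg.upper a x h
  · have hxA : x ∉ A := fun h' => hx (wt_injective (le_antisymm (hT.le x h') h))
    rw [hg.outside a x (Or.inr hxA), if_neg hx.symm]

/-- The row `a` of `g` has only its diagonal entry, as `a` is largest, and the row `a` of `Q` can be
nonzero only at `m`. Up to a scalar, this row is the column `m` of `g`. -/
theorem conj_row_top (hg : IsBorelOn A g) (q : Fin n ⊕ Fin n) :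
    (g * Q * gᵀ) a q = g a a * Q a m * g q m := by
  rw [conj_apply, Finset.sum_eq_single a, Finset.sum_eq_single m]
  · intro y _ hy
    have : Q a y = 0 := by
      by_contra h
      obtain ⟨_, rfl, _⟩ := (hT.form_ne_zero a y).1 h
      rw [hT.map_top, Sum.swap_swap] at hy
      exact hy rfl
    rw [this]; ring
  · simp
  · intro x _ hx
    simp [hT.row_top hg hx]
  · simp

/-- On core rows the column `-a` vanishes by triangularity and the column `m` by `hcol`. These
represent the deleted pairs `±a` and `±m`, as `isBorelOn_restr` requires. -/
theorem isBorelOn_restr_core (hg : IsBorelOn A g)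
    (hcol : ∀ q, q ≠ m → q ≠ a.swap → g q m = 0) :
    IsBorelOn (core A a m) (restr (core A a m) g) := by
  have hm : ∀ r ∈ core A a m, g r m = 0 := fun r hr =>
    hcol r (mem_core.1 hr).2.2.2.1 (mem_core.1 hr).2.2.1
  have ha : ∀ r ∈ core A a m, g r a.swap = 0 := fun r hr => by
    refine hg.upper _ _ (lt_of_le_of_ne ?_ fun h => (mem_core.1 hr).2.2.1 (wt_injective h.symm))
    rw [wt_swap]
    exact hT.neg_le (core_subset hr)
  refine isBorelOn_restr hg (fun r => hT.core_symm) fun b hb => ?_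
  by_cases hbA : b ∈ A
  · rw [mem_core] at hb
    by_cases h1 : b = a
    · subst h1; exact Or.inr ha
    by_cases h2 : b = a.swap
    · subst h2; exact Or.inl ha
    by_cases h3 : b = m
    · subst h3; exact Or.inl hm
    by_cases h4 : b = m.swap
    · subst h4; exact Or.inr (by simpa using hm)
    tauto
  · refine Or.inl fun r hr => ?_
    rw [hg.outside r b (Or.inr hbA), if_neg]
    rintro rfl
    exact hbA (core_subset hr)

/-- The column `m` lives at `m` and `-a` only, and `g a x = 0`. The symplectic relation between the
columns `x` and `m` thus reduces to the single product of `g m.swap x` with the nonzero `g m m`. -/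
theorem row_neg_partner (hg : IsBorelOn A g) (hcol : ∀ q, q ≠ m → q ≠ a.swap → g q m = 0)
    {x : Fin n ⊕ Fin n} (hx : x ∈ core A a m) : g m.swap x = 0 := by
  obtain ⟨-, hxa, -, -, hxm⟩ := mem_core.1 hx
  have h := sum_col_of_symplectic hg.symplectic x m
  rw [Finset.sum_eq_single m.swap, if_neg hxm, Sum.swap_swap] at h
  · have h1 := hg.diag_ne_zero m
    have h2 := sgn_ne_zero m.swap
    simpa [h1, h2, sgn_ne_zero] using h
  · intro b _ hb
    by_cases hba : b = a
    · rw [hba, hT.row_top hg hxa]; ring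
    · rw [hcol b.swap (fun h => hb (swap_eq_iff.1 h))
        (fun h => hba (by rw [← Sum.swap_swap b, h, Sum.swap_swap])), mul_zero]
  · simp

theorem conj_core (hg : IsBorelOn A g) (hcol : ∀ q, q ≠ m → q ≠ a.swap → g q m = 0)
    {r q : Fin n ⊕ Fin n} (hrq : 0 < wt r + wt q) (hra : r ≠ a) (hrm : r ≠ m) (hqa : q ≠ a)
    (hqm : q ≠ m) : (g * Q * gᵀ) r q =
      (restr (core A a m) g * coreForm A a m Q * (restr (core A a m) g)ᵀ) r q := by
  have hD' := hT.core_isDatum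
  have hg' := hT.isBorelOn_restr_core hg hcol
  have hleft : ∀ r q, 0 < wt r + wt q → r ≠ a → r ≠ m → q ≠ a → q ≠ m → r ∉ core A a m →
      (g * Q * gᵀ) r q = 0 := by
    intro r q hrq hra hrm hqa hqm hr
    by_cases hrA : r ∈ A
    swap
    · exact hT.conj_eq_zero_of_notMem hg hrA
    by_cases hr' : r = a.swap
    · rw [hT.conj_symm]
      refine hT.conj_eq_zero_of_notMem hg fun hq => ?_
      have := hT.le q hq
      rw [hr', wt_swap] at hrq
      omega
    by_cases hqA : q ∈ A
    swap
    · rw [hT.conj_symm]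
      exact hT.conj_eq_zero_of_notMem hg hqA
    have hq' : q ≠ a.swap := by
      rintro rfl
      have := hT.le r hrA
      rw [wt_swap] at hrq
      omega
    have hrm' : r = m.swap := by
      by_contra h
      exact hr (mem_core.2 ⟨hrA, hra, hr', hrm, h⟩)
    rw [conj_apply]
    refine Finset.sum_eq_zero fun x _ => Finset.sum_eq_zero fun y _ => ?_
    by_cases h : Q x y = 0
    · rw [h]; ring
    rcases hT.form_cases h with ⟨hx, -⟩ | ⟨-, rfl⟩ | ⟨rfl, -⟩
    · rw [hrm', hT.row_neg_partner hg hcol hx]; ring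
    · rw [hcol q hqm hq']; ring
    · rw [hcol r hrm hr']; ring
  by_cases hr : r ∈ core A a m
  swap
  · rw [hD'.conj_eq_zero_of_notMem hg' hr, hleft r q hrq hra hrm hqa hqm hr]
  by_cases hq : q ∈ core A a m
  swap
  · rw [hD'.conj_symm, hD'.conj_eq_zero_of_notMem hg' hq, hT.conj_symm,
      hleft q r (by omega) hqa hqm hra hrm hq]
  rw [conj_apply, conj_apply]
  refine Finset.sum_congr rfl fun x _ => Finset.sum_congr rfl fun y _ => ?_
  by_cases h : Q x y = 0
  · rw [coreForm, h]; simp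
  rcases hT.form_cases h with ⟨hx, hy⟩ | ⟨rfl, rfl⟩ | ⟨rfl, rfl⟩
  · simp [restr, coreForm, hr, hq, hx, hy]
  · rw [hcol q hqm (mem_core.1 hq).2.2.1, coreForm, if_neg (by simp [mem_core])]; ring
  · rw [hcol r hrm (mem_core.1 hr).2.2.1, coreForm, if_neg (by simp [mem_core])]; ring

end IsTop

/-- The indices of the free entries in the row `m`. -/
def rowSet (A : Finset (Fin n ⊕ Fin n)) (a m : Fin n ⊕ Fin n) : Finset (Fin n ⊕ Fin n) :=
  A.filter fun q => 0 < wt m + wt q ∧ q ≠ a ∧ m ≠ a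

/-- The indices of the free entries in the row `a`. -/
def topSet (A : Finset (Fin n ⊕ Fin n)) (a m : Fin n ⊕ Fin n) : Finset (Fin n ⊕ Fin n) :=
  A.filter fun q => - wt a < wt q ∧ wt q ≤ wt m

theorem mem_rowSet {q : Fin n ⊕ Fin n} :
    q ∈ rowSet A a m ↔ q ∈ A ∧ 0 < wt m + wt q ∧ q ≠ a ∧ m ≠ a := by simp [rowSet]

theorem mem_topSet {q : Fin n ⊕ Fin n} :
    q ∈ topSet A a m ↔ q ∈ A ∧ - wt a < wt q ∧ wt q ≤ wt m := by simp [topSet]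

/-- The symmetric matrix with the entry `c` at `(a, m)`, the row `w` at `m` and the entries `y`
elsewhere. -/
def recon (a m : Fin n ⊕ Fin n) (c : ℂ) (w : Fin n ⊕ Fin n → ℂ)
    (y : (Fin n ⊕ Fin n) × (Fin n ⊕ Fin n) → ℂ) : Matrix (Fin n ⊕ Fin n) (Fin n ⊕ Fin n) ℂ :=
  fun r q => if r = a then (if q = m then c else 0) else if q = a then (if r = m then c else 0) else
    if r = m then w q else if q = m then w r else y (r, q)

/-- Once the column `m` of `g` is straight, the form splits: one entry in the row `a`, an
unconstrained row `m`, and a point of the orbit of the core form. -/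
theorem IsTop.conj_eq_recon (hT : IsTop A τ Q a m) (hg : IsBorelOn A g)
    (hcol : ∀ q, q ≠ m → q ≠ a.swap → g q m = 0) :
    trunc (g * Q * gᵀ) = trunc (recon a m (g a a * Q a m * g m m)
      (fun q => if q ∈ rowSet A a m then (g * Q * gᵀ) m q else 0)
      (orbitFamily (core A a m) (coreForm A a m Q) ⟨_, hT.isBorelOn_restr_core hg hcol⟩)) := by
  have hrow : ∀ q, 0 < wt a + wt q → (g * Q * gᵀ) a q =
      if q = m then g a a * Q a m * g m m else 0 := by
    intro q hq
    rw [hT.conj_row_top hg]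
    split_ifs with h
    · rw [h]
    · rw [hcol q h, mul_zero]
      rintro rfl
      rw [wt_swap] at hq
      omega
  have hm : ∀ q, 0 < wt m + wt q → q ≠ a → m ≠ a → (g * Q * gᵀ) m q =
      if q ∈ rowSet A a m then (g * Q * gᵀ) m q else 0 := by
    intro q hq h1 h2
    split_ifs with h
    · rfl
    · rw [hT.conj_symm]
      exact hT.conj_eq_zero_of_notMem hg fun h' => h (mem_rowSet.2 ⟨h', hq, h1, h2⟩)
  ext r q
  simp only [trunc]
  split_ifs with hrq
  swap
  · rfl
  simp only [recon]
  split_ifs with h1 h2 h3 h4 h5 h6 h7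
  · rw [h1, hrow q (by rwa [h1] at hrq), if_pos h2]
  · rw [h1, hrow q (by rwa [h1] at hrq), if_neg h2]
  · rw [hT.conj_symm, h3, hrow r (by rw [h3] at hrq; omega), if_pos h4]
  · rw [hT.conj_symm, h3, hrow r (by rw [h3] at hrq; omega), if_neg h4]
  · rw [h5]
  · subst h5
    rw [hm q hrq h3 h1, if_neg h6]
  · rw [hT.conj_symm, h7]
  · subst h7
    rw [hT.conj_symm, hm r (by omega) h1 h3, if_neg ‹_›]
  · rw [orbitFamily, trunc_apply hrq]
    exact hT.conj_core hg hcol hrq h1 h5 h3 ‹_›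

end Forms

section Induction

variable {n : ℕ} {A : Finset (Fin n ⊕ Fin n)} {τ : Fin n ⊕ Fin n → Fin n ⊕ Fin n}
  {Q g h : Matrix (Fin n ⊕ Fin n) (Fin n ⊕ Fin n) ℂ} {a m : Fin n ⊕ Fin n}

/-! ### Straightening the column of the partner of the largest index -/

theorem IsBorelOn.mul_diag (hg : IsBorelOn A g) (hh : IsBorelOn A h) (r : Fin n ⊕ Fin n) :
    (g * h) r r = g r r * h r r := by
  rw [Matrix.mul_apply, Finset.sum_eq_single r]
  · intro x _ hx
    rcases lt_trichotomy (wt x) (wt r) with h1 | h1 | h1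
    · rw [hg.upper r x h1, zero_mul]
    · exact absurd (wt_injective h1) hx
    · rw [hh.upper x r h1, mul_zero]
  · simp

theorem elem_diag {b : Fin n ⊕ Fin n} {v : Fin n ⊕ Fin n → ℂ} (hv : v b = 0)
    (r : Fin n ⊕ Fin n) : elem b v r r = 1 := by
  have h1 : (if r = b then v r else 0) = 0 := by
    split_ifs with h
    exacts [h ▸ hv, rfl]
  have h2 : (if r = b.swap then sgn b * sgn r * v r.swap else 0) = 0 := by
    split_ifs with h
    · rw [h, Sum.swap_swap, hv, mul_zero]
    · rfl
  simp only [elem, nilp, Matrix.add_apply, Matrix.one_apply_eq, h1, h2, add_zero]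

theorem elem_neg_mul_elem {b : Fin n ⊕ Fin n} {v : Fin n ⊕ Fin n → ℂ} (hv : v b = 0) :
    elem b (fun r => - v r) * elem b v = 1 := by
  simpa using elem_mul_elem_neg (b := b) (v := fun r => - v r) (by simp [hv])

theorem elem_mul_apply (b : Fin n ⊕ Fin n) (v : Fin n ⊕ Fin n → ℂ)
    (g : Matrix (Fin n ⊕ Fin n) (Fin n ⊕ Fin n) ℂ) (r q : Fin n ⊕ Fin n) :
    (elem b v * g) r q = g r q + v r * g b q +
      if r = b.swap then sgn b * ∑ x, sgn x * v x.swap * g x q else 0 := by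
  rw [elem, add_mul, one_mul, Matrix.add_apply, Matrix.mul_apply, add_assoc]
  simp only [nilp, add_mul, Finset.sum_add_distrib, ite_mul, zero_mul, Finset.sum_ite_eq',
    Finset.mem_univ, if_true]
  split_ifs
  · simp only [Finset.mul_sum, mul_assoc]
  · simp

/-- The column at `m` of the unipotent matrix that straightens the row `u`. -/
def vcol (A : Finset (Fin n ⊕ Fin n)) (a m : Fin n ⊕ Fin n) (u : Fin n ⊕ Fin n → ℂ)
    (q : Fin n ⊕ Fin n) : ℂ :=
  if q ∈ A ∧ - wt a < wt q ∧ wt q < wt m then (if q = m.swap then 1 / 2 else 1) * (u q / u m) else 0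

theorem vcol_self (u : Fin n ⊕ Fin n → ℂ) : vcol A a m u m = 0 := by simp [vcol]

theorem vcol_congr {u u' : Fin n ⊕ Fin n → ℂ} (hm : m ∈ topSet A a m)
    (h : ∀ q ∈ topSet A a m, u q = u' q) : vcol A a m u = vcol A a m u' := by
  ext q
  simp only [vcol]
  split_ifs with h1 h2 <;> first | rfl | rw [h m hm, h q (mem_topSet.2 ⟨h1.1, h1.2.1, h1.2.2.le⟩)]

theorem elem_vcol_col {u : Fin n ⊕ Fin n → ℂ} (hu : u m ≠ 0) {q : Fin n ⊕ Fin n}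
    (hq : q ∈ topSet A a m) : elem m (vcol A a m u) q m = u q / u m := by
  obtain ⟨hqA, hqa, hqm⟩ := mem_topSet.1 hq
  by_cases h : q = m
  · rw [h, elem_diag (vcol_self u), div_self hu]
  have hlt : wt q < wt m := lt_of_le_of_ne hqm fun h' => h (wt_injective h')
  have hv : vcol A a m u q = (if q = m.swap then 1 / 2 else 1) * (u q / u m) :=
    if_pos ⟨hqA, hqa, hlt⟩
  simp only [elem, nilp, Matrix.add_apply, Matrix.one_apply_ne h, if_true]
  -- The place `(-m, m)` receives the same value from the column and from its matching row; the
  -- factor `1 / 2` in `vcol` compensates for this.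
  by_cases h' : q = m.swap
  · rw [if_pos h', ← h', hv, if_pos h', sgn_mul_sgn]; ring
  · rw [if_neg h', hv, if_neg h']; ring

theorem IsTop.isBorelOn_elem_vcol (hT : IsTop A τ Q a m) (u : Fin n ⊕ Fin n → ℂ) :
    IsBorelOn A (elem m (vcol A a m u)) := by
  refine isBorelOn_elem hT.symm hT.partner_mem fun r hr => ?_
  simp only [vcol] at hr
  split_ifs at hr with h1
  · exact ⟨h1.1, h1.2.2⟩
  · exact ⟨h1.1, h1.2.2⟩
  · exact absurd rfl hr

theorem IsTop.isBorelOn_elem_neg_vcol (hT : IsTop A τ Q a m) (u : Fin n ⊕ Fin n → ℂ) :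
    IsBorelOn A (elem m fun r => - vcol A a m u r) := by
  refine isBorelOn_elem hT.symm hT.partner_mem fun r hr => ?_
  simp only [vcol, ne_eq, neg_eq_zero] at hr
  split_ifs at hr with h1
  · exact ⟨h1.1, h1.2.2⟩
  · exact ⟨h1.1, h1.2.2⟩
  · exact absurd rfl hr

theorem IsTop.neg_lt_partner (hT : IsTop A τ Q a m) (hne : m ≠ a.swap) : - wt a < wt m := by
  refine lt_of_le_of_ne (hT.neg_le hT.partner_mem) fun h => hne (wt_injective ?_)
  rw [wt_swap, h]

theorem IsTop.partner_mem_topSet (hT : IsTop A τ Q a m) (hne : m ≠ a.swap) :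
    m ∈ topSet A a m := mem_topSet.2 ⟨hT.partner_mem, hT.neg_lt_partner hne, le_rfl⟩

theorem IsTop.form_top_ne_zero (hT : IsTop A τ Q a m) (hne : m ≠ a.swap) : Q a m ≠ 0 := by
  rw [hT.form_ne_zero, hT.map_top, Sum.swap_swap, wt_swap]
  have := hT.neg_lt_partner hne
  exact ⟨hT.mem, rfl, by omega⟩

/-- The row `u` is a multiple of the column `m` of `g`, so `vcol` is that column normalised by its
diagonal entry and halved at `-m`. Subtraction clears all places except `-m`, where the matching row
of the elementary matrix supplies the missing half. The entry at `-a` is invisible in the truncated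
form and is not cleared. -/
theorem IsTop.straighten (hT : IsTop A τ Q a m) (hne : m ≠ a.swap) (hg : IsBorelOn A g)
    {u : Fin n ⊕ Fin n → ℂ} {c : ℂ} (hc : c ≠ 0)
    (hu : ∀ q ∈ A, - wt a < wt q → u q = c * g q m) (q : Fin n ⊕ Fin n) (hqm : q ≠ m)
    (hqa : q ≠ a.swap) : (elem m (fun r => - vcol A a m u r) * g) q m = 0 := by
  have hmm := hg.diag_ne_zero m
  have hle := hT.le m hT.partner_mem
  let f : Fin n ⊕ Fin n → ℂ := fun x =>
    if x ∈ A ∧ - wt a < wt x ∧ wt x < wt m then g x m / g m m else 0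
  have hfm : f m = 0 := by simp [f]
  have hfa : f a = 0 := if_neg fun h => by omega
  have hv : ∀ x, vcol A a m u x = (if x = m.swap then 1 / 2 else 1) * f x := by
    intro x
    simp only [vcol, f]
    by_cases hx : x ∈ A ∧ - wt a < wt x ∧ wt x < wt m
    · rw [if_pos hx, if_pos hx, hu x hx.1 hx.2.1, hu m hT.partner_mem (hT.neg_lt_partner hne),
        mul_div_mul_left _ _ hc]
    · rw [if_neg hx, if_neg hx, mul_zero]
  have hgf : ∀ x, x ≠ a.swap → g x m = g m m * (f x + if x = m then 1 else 0) := by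
    intro x hxa
    by_cases hxm : x = m
    · subst hxm; rw [hfm, if_pos rfl]; ring
    rw [if_neg hxm, add_zero]
    by_cases hxA : x ∈ A
    · have h1 : - wt a < wt x := by
        refine lt_of_le_of_ne (hT.neg_le hxA) fun h => hxa (wt_injective ?_)
        rw [wt_swap, h]
      rcases lt_trichotomy (wt x) (wt m) with h | h | h
      · rw [show f x = g x m / g m m from if_pos ⟨hxA, h1, h⟩]; field_simp
      · exact absurd (wt_injective h) hxm
      · rw [hg.upper x m h, show f x = 0 from if_neg fun h' => by omega, mul_zero]
    · rw [hg.outside x m (Or.inl hxA), if_neg hxm,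
        show f x = 0 from if_neg fun h' => hxA h'.1, mul_zero]
  -- Every vector is isotropic for the alternating form, so only the diagonal entry of the column
  -- contributes. The halving does not matter here, because it meets `f m = 0`; at `x = -a` the
  -- factor `f a` vanishes.
  have hsum : ∑ x, sgn x * vcol A a m u x.swap * g x m = g m m * (sgn m * vcol A a m u m.swap) := by
    have h1 : ∀ x, sgn x * vcol A a m u x.swap * g x m =
        g m m * (sgn x * f x.swap * f x) +
          if x = m then g m m * (sgn x * vcol A a m u x.swap) else 0 := by
      intro x
      by_cases hxa : x = a.swap
      · rw [hv, hxa, Sum.swap_swap, hfa, if_neg hne.symm]; ring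
      rw [hgf x hxa]
      by_cases hxm : x = m
      · rw [hxm, hfm, if_pos rfl, if_pos rfl]; ring
      · rw [if_neg hxm, if_neg hxm, hv, if_neg (fun h' => hxm ?_)]
        · ring
        · rw [← Sum.swap_swap x, h', Sum.swap_swap]
    simp only [h1, Finset.sum_add_distrib, ← Finset.mul_sum, sum_sgn_mul_swap, mul_zero, zero_add,
      Finset.sum_ite_eq', Finset.mem_univ, if_true]
  have hneg : ∑ x, sgn x * -vcol A a m u x.swap * g x m =
      - (g m m * (sgn m * vcol A a m u m.swap)) := by
    rw [← hsum, ← Finset.sum_neg_distrib]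
    exact Finset.sum_congr rfl fun x _ => by ring
  rw [elem_mul_apply, hneg, hgf q hqa, if_neg hqm, hv]
  by_cases hq : q = m.swap
  · rw [if_pos hq, if_pos hq, hv, if_pos rfl, ← hq]
    linear_combination (-(1 / 2) * f q * g m m) * sgn_mul_sgn m
  · rw [if_neg hq, if_neg hq]; ring

/-! ### Counting inversions -/

/-- Inversions are sorted into those containing `a`, those containing `m` but not `a`, and the rest,
which lie in the core. If `m = a`, the second class is empty. -/
theorem IsTop.card_inversions (hT : IsTop A τ Q a m) :
    (inversions A τ).card = (A.filter fun q => wt (τ q) < wt m).card + (rowSet A a m).card +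
      (inversions (core A a m) τ).card := by
  classical
  have hinj : ∀ b : Fin n ⊕ Fin n, Function.Injective fun q => s(b, q) := fun b q q' h =>
    Sym2.congr_right.1 h
  rw [← Finset.card_image_of_injective _ (hinj a),
    ← Finset.card_image_of_injective (rowSet A a m) (hinj m)]
  have hle := hT.le m hT.partner_mem
  have hta : wt (τ a) = - wt m := by rw [hT.map_top, wt_swap]
  have htm : wt (τ m) = - wt a := by rw [hT.map_partner, wt_swap]
  rw [← Finset.card_union_of_disjoint, ← Finset.card_union_of_disjoint]
  · congr 1
    -- Positivity of the sum fails only for `q = -a`, whose image `m` violates the right-hand side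
    -- too.
    have hkey : ∀ q, s(a, q) ∈ inversions A τ ↔ q ∈ A ∧ wt (τ q) < wt m := by
      intro q
      rw [mem_inversions, hta]
      constructor
      · rintro ⟨⟨-, h⟩, h1, h2⟩
        exact ⟨h, by omega⟩
      · rintro ⟨h, h1⟩
        refine ⟨⟨hT.mem, h⟩, ?_, by omega⟩
        have := hT.neg_le h
        rcases this.eq_or_lt with h2 | h2
        · rw [← wt_swap, wt_inj] at h2
          rw [← h2, hT.map_swap, hT.map_top, Sum.swap_swap] at h1
          omega
        · omega
    -- The image sum is automatically negative: `τ q = a` would mean `q = -m`, where the original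
    -- sum is zero.
    have hkey' : ∀ q, q ≠ a → m ≠ a → (s(m, q) ∈ inversions A τ ↔ q ∈ rowSet A a m) := by
      intro q hq hma
      rw [mem_inversions, mem_rowSet, htm]
      constructor
      · rintro ⟨⟨-, h⟩, h1, h2⟩
        exact ⟨h, h1, hq, hma⟩
      · rintro ⟨h, h1, -⟩
        refine ⟨⟨hT.partner_mem, h⟩, h1, ?_⟩
        rcases (hT.le _ (hT.map_mem q h)).eq_or_lt with h2 | h2
        · rw [wt_inj] at h2
          have h3 := hT.map_map q
          rw [h2, hT.map_top] at h3
          rw [← h3, wt_swap] at h1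
          omega
        · omega
    ext p
    induction p using Sym2.ind with
    | _ r q =>
    by_cases hra : r = a
    · subst hra
      rw [hkey]
      simp only [Finset.mem_union, Finset.mem_image, Finset.mem_filter, mem_inversions, mem_core,
        mem_rowSet]
      constructor
      · intro h
        exact Or.inl (Or.inl ⟨q, h, rfl⟩)
      · rintro ((⟨q', h, h'⟩ | ⟨q', h, h'⟩) | h)
        · rwa [← hinj r h']
        · rw [Sym2.eq_iff] at h'
          exfalso
          rcases h' with ⟨h1, -⟩ | ⟨-, h1⟩
          · exact h.2.2.2 h1
          · exact h.2.2.1 h1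
        · exact absurd rfl h.1.1.2.1
    by_cases hqa : q = a
    · subst hqa
      rw [Sym2.eq_swap, hkey]
      simp only [Finset.mem_union, Finset.mem_image, Finset.mem_filter, mem_inversions, mem_core,
        mem_rowSet]
      constructor
      · intro h
        exact Or.inl (Or.inl ⟨r, h, rfl⟩)
      · rintro ((⟨q', h, h'⟩ | ⟨q', h, h'⟩) | h)
        · rwa [← hinj q h']
        · rw [Sym2.eq_iff] at h'
          exfalso
          rcases h' with ⟨h1, -⟩ | ⟨-, h1⟩
          · exact h.2.2.2 h1
          · exact h.2.2.1 h1
        · exact absurd rfl h.1.1.2.1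
    have hno : ∀ (s : Finset (Fin n ⊕ Fin n)), s(r, q) ∉ s.image fun q => s(a, q) := by
      intro s h
      obtain ⟨q', -, h'⟩ := Finset.mem_image.1 h
      rw [Sym2.eq_iff] at h'
      rcases h' with ⟨h1, -⟩ | ⟨h1, -⟩
      · exact hra h1.symm
      · exact hqa h1.symm
    rw [Finset.mem_union, Finset.mem_union, or_iff_right (hno _)]
    by_cases hrm : r = m
    · subst hrm
      rw [hkey' q hqa hra]
      simp only [Finset.mem_image, mem_inversions, mem_core]
      constructor
      · intro h
        exact Or.inl ⟨q, h, rfl⟩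
      · rintro (⟨q', h, h'⟩ | h)
        · rwa [← hinj r h']
        · exact absurd rfl h.1.1.2.2.2.1
    by_cases hqm : q = m
    · subst hqm
      rw [Sym2.eq_swap, hkey' r hra hqa]
      simp only [Finset.mem_image, mem_inversions, mem_core]
      constructor
      · intro h
        exact Or.inl ⟨r, h, rfl⟩
      · rintro (⟨q', h, h'⟩ | h)
        · rwa [← hinj q h']
        · exact absurd rfl h.1.1.2.2.2.1
    have hno' : ∀ (s : Finset (Fin n ⊕ Fin n)), s(r, q) ∉ s.image fun q => s(m, q) := by
      intro s h
      obtain ⟨q', -, h'⟩ := Finset.mem_image.1 h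
      rw [Sym2.eq_iff] at h'
      rcases h' with ⟨h1, -⟩ | ⟨h1, -⟩
      · exact hrm h1.symm
      · exact hqm h1.symm
    rw [or_iff_right (hno' _), mem_inversions, mem_inversions]
    -- The index `-a` allows no positive sum, and `-m` is sent to `a`, which allows no negative one.
    have hstep : ∀ r q, r ∈ A → q ∈ A → 0 < wt r + wt q → wt (τ r) + wt (τ q) < 0 → r ≠ a →
        r ≠ m → r ∈ core A a m := by
      intro r q hr hq h1 h2 h3 h4
      refine mem_core.2 ⟨hr, h3, ?_, h4, ?_⟩
      · rintro rfl
        have := hT.le q hq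
        rw [wt_swap] at h1
        omega
      · rintro rfl
        rw [hT.map_swap, hT.map_partner, Sum.swap_swap] at h2
        have := hT.neg_le (hT.map_mem q hq)
        omega
    constructor
    · rintro ⟨⟨hr, hq⟩, h1, h2⟩
      exact ⟨⟨hstep r q hr hq h1 h2 hra hrm,
        hstep q r hq hr (by omega) (by omega) hqa hqm⟩, h1, h2⟩
    · rintro ⟨⟨hr, hq⟩, h1, h2⟩
      exact ⟨⟨core_subset hr, core_subset hq⟩, h1, h2⟩
  · rw [Finset.disjoint_left]
    intro p hp hp'
    induction p using Sym2.ind with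
    | _ r q =>
    rw [mem_inversions, mem_core, mem_core] at hp'
    rcases Finset.mem_union.1 hp with hp | hp <;> obtain ⟨q', -, h'⟩ := Finset.mem_image.1 hp <;>
      rw [Sym2.eq_iff] at h' <;> rcases h' with ⟨h1, -⟩ | ⟨h1, -⟩
    · exact hp'.1.1.2.1 h1.symm
    · exact hp'.1.2.2.1 h1.symm
    · exact hp'.1.1.2.2.2.1 h1.symm
    · exact hp'.1.2.2.2.2.1 h1.symm
  · rw [Finset.disjoint_left]
    intro p hp hp'
    obtain ⟨q, hq, rfl⟩ := Finset.mem_image.1 hp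
    obtain ⟨q', hq', h'⟩ := Finset.mem_image.1 hp'
    rw [mem_rowSet] at hq'
    rw [Sym2.eq_iff] at h'
    rcases h' with ⟨h1, -⟩ | ⟨-, h1⟩
    · exact hq'.2.2.2 h1
    · exact hq'.2.2.1 h1

/-- Since `τ` permutes `A`, the indices with image below `m` are as many as those below `m`.
Exchanging the least index `-a` for `m` gives `topSet`. -/
theorem IsTop.card_topSet (hT : IsTop A τ Q a m) (hne : m ≠ a.swap) :
    (A.filter fun q => wt (τ q) < wt m).card = (topSet A a m).card := by
  classical
  have h1 : (A.filter fun q => wt (τ q) < wt m).card = (A.filter fun q => wt q < wt m).card := by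
    refine Finset.card_nbij' τ τ ?_ ?_ (fun q _ => hT.map_map q) (fun q _ => hT.map_map q)
    · intro q hq
      simp only [Finset.coe_filter, Set.mem_ofPred_eq] at hq ⊢
      exact ⟨hT.map_mem q hq.1, hq.2⟩
    · intro q hq
      simp only [Finset.coe_filter, Set.mem_ofPred_eq] at hq ⊢
      exact ⟨hT.map_mem q hq.1, by rw [hT.map_map]; exact hq.2⟩
  have h2 : insert m (A.filter fun q => wt q < wt m) = insert a.swap (topSet A a m) := by
    ext q
    simp only [Finset.mem_insert, Finset.mem_filter, mem_topSet, ← wt_inj, wt_swap]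
    have h3 := hT.neg_lt_partner hne
    constructor
    · rintro (h | ⟨h, h'⟩)
      · right
        rw [wt_inj] at h
        subst h
        exact ⟨hT.partner_mem, h3, le_rfl⟩
      · have := hT.neg_le h
        by_cases h4 : wt q = - wt a
        · exact Or.inl h4
        · exact Or.inr ⟨h, by omega, h'.le⟩
    · rintro (h | ⟨h, h', h''⟩)
      · right
        rw [← wt_swap, wt_inj] at h
        subst h
        exact ⟨hT.symm a hT.mem, by rwa [wt_swap]⟩
      · rcases h''.eq_or_lt with h4 | h4
        · exact Or.inl h4
        · exact Or.inr ⟨h, h4⟩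
  have h3 := congrArg Finset.card h2
  rw [Finset.card_insert_of_notMem (by simp), Finset.card_insert_of_notMem
    (by simp [mem_topSet])] at h3
  omega

end Induction

section Cells

variable {n : ℕ} {A : Finset (Fin n ⊕ Fin n)} {τ : Fin n ⊕ Fin n → Fin n ⊕ Fin n}
  {Q g h : Matrix (Fin n ⊕ Fin n) (Fin n ⊕ Fin n) ℂ} {a m : Fin n ⊕ Fin n}

/-! ### The orbits are cells -/

theorem IsCell.comp_surjective {X Y ι : Type*} {F : X → ι → ℂ} {k : ℕ} {π : Y → X}
    (hπ : Function.Surjective π) (h : IsCell F k) : IsCell (fun y => F (π y)) k := by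
  obtain ⟨κ, i, E, G, hc, hG, hF, hr⟩ := h
  exact ⟨κ, i, E, fun y => G (π y), hc, fun k => comp_mem_reg (hG k) π,
    fun k => comp_mem_reg (hF k) π, by rw [← hr]; exact hπ.range_comp G⟩

theorem elem_mem_reg {X ι : Type*} {F : X → ι → ℂ} {b : Fin n ⊕ Fin n}
    {v : X → Fin n ⊕ Fin n → ℂ} (hv : ∀ q, (fun x => v x q) ∈ Reg F) (r q : Fin n ⊕ Fin n) :
    (fun x => elem b (v x) r q) ∈ Reg F := by
  simp only [elem, nilp, Matrix.add_apply]
  refine add_mem_reg (const_mem_reg F _) (add_mem_reg ?_ ?_)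
  · split_ifs
    · exact hv r
    · exact const_mem_reg F 0
  · split_ifs
    · exact mul_mem_reg (const_mem_reg F _) (hv _)
    · exact const_mem_reg F 0

theorem trunc_conj_mem_reg {X ι : Type*} {F : X → ι → ℂ}
    {g M : X → Matrix (Fin n ⊕ Fin n) (Fin n ⊕ Fin n) ℂ}
    (hg : ∀ r q, (fun x => g x r q) ∈ Reg F) (hM : ∀ r q, (fun x => trunc (M x) r q) ∈ Reg F)
    (r q : Fin n ⊕ Fin n) : (fun x => trunc (g x * trunc (M x) * (g x)ᵀ) r q) ∈ Reg F := by
  simp only [trunc]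
  split_ifs
  · simp only [conj_apply]
    exact sum_mem_reg _ fun y _ => sum_mem_reg _ fun z _ =>
      mul_mem_reg (mul_mem_reg (hg r y) (hM y z)) (hg q z)
  · exact const_mem_reg F 0

theorem isBorelOn_diagonal {d : Fin n ⊕ Fin n → ℂ} (h1 : ∀ r, d r * d r.swap = 1)
    (h2 : ∀ r, r ∉ A → d r = 1) : IsBorelOn A (Matrix.diagonal d) := by
  refine ⟨fun r q hrq => Matrix.diagonal_apply_ne _ fun h => ?_, ?_, fun r q hrq => ?_⟩
  · subst h; exact lt_irrefl _ hrq
  · rw [mem_symplectic_iff]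
    intro r q
    rw [Finset.sum_eq_single r]
    · by_cases h : r = q.swap
      · subst h
        have := h1 q
        simp only [Matrix.diagonal_apply_eq, Sum.swap_swap, if_true]
        linear_combination sgn q.swap * this
      · rw [if_neg h, Matrix.diagonal_apply_ne _ fun h' => h (swap_eq_iff.1 h'.symm), mul_zero]
    · intro b _ hb
      rw [Matrix.diagonal_apply_ne _ hb.symm, zero_mul, zero_mul]
    · simp
  · rw [Matrix.diagonal_apply]
    split_ifs with h
    · subst h; exact h2 r (by tauto)
    · rfl

/-- The largest index is fixed by `τ`: the orbit does not change when it is removed. -/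
theorem IsTop.isCell_of_fixed (hT : IsTop A τ Q a m) (hm : m = a.swap) {k : ℕ}
    (ih : IsCell (orbitFamily (core A a m) (coreForm A a m Q)) k) :
    IsCell (orbitFamily A Q) k := by
  -- Here `m = -a` is the smallest index of `A`, so triangularity already makes its column straight.
  have hcol : ∀ g : {g // IsBorelOn A g}, ∀ q, q ≠ m → q ≠ a.swap → g.1 q m = 0 := by
    intro g q hqm hqa
    by_cases hq : q ∈ A
    · refine g.2.upper _ _ (lt_of_le_of_ne ?_ fun h => hqm (wt_injective h.symm))
      rw [hm, wt_swap]
      exact hT.neg_le hq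
    · rw [g.2.outside q m (Or.inl hq), if_neg hqm]
  have hQ : Q a m = 0 := by
    by_contra h
    have := ((hT.form_ne_zero a m).1 h).2.2
    rw [hT.map_top, hm, Sum.swap_swap] at this
    exact lt_irrefl _ this
  have hrow : rowSet A a m = ∅ := by
    rw [Finset.eq_empty_iff_forall_notMem]
    intro q hq
    obtain ⟨h1, h2, -⟩ := mem_rowSet.1 hq
    have := hT.le q h1
    rw [hm, wt_swap] at h2
    omega
  let π : {g // IsBorelOn A g} → {g // IsBorelOn (core A a m) g} := fun g =>
    ⟨_, hT.isBorelOn_restr_core g.2 (hcol g)⟩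
  have hπ : Function.Surjective π := fun g =>
    ⟨⟨g.1, g.2.mono core_subset⟩, Subtype.ext (restr_eq_self g.2)⟩
  convert ih.comp_surjective hπ using 1
  funext g p
  obtain ⟨r, q⟩ := p
  have h1 := congrFun (congrFun (hT.conj_eq_recon g.2 (hcol g)) r) q
  rw [orbitFamily, h1]
  have hzero : ∀ r q, r ∉ core A a m →
      orbitFamily (core A a m) (coreForm A a m Q) (π g) (r, q) = 0 ∧
      orbitFamily (core A a m) (coreForm A a m Q) (π g) (q, r) = 0 := by
    intro r q hr
    have h := hT.core_isDatum.conj_eq_zero_of_notMem (π g).2 (q := q) hr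
    have h' := h
    rw [hT.core_isDatum.conj_symm] at h'
    simp only [orbitFamily, trunc, h, h', ite_self, and_self]
  have ha : a ∉ core A a m := by simp [mem_core]
  have hm' : m ∉ core A a m := by simp [mem_core]
  simp only [recon, hQ, hrow, trunc, mul_zero, zero_mul, ite_self, Finset.notMem_empty, if_false]
  split_ifs with h2 h3 h4 h5 h6
  · rw [h3, (hzero a q ha).1]
  · rw [h4, (hzero a r ha).2]
  · rw [h5, (hzero m q hm').1]
  · rw [h6, (hzero m r hm').2]
  · rfl
  · simp only [orbitFamily, trunc, if_neg h2]

/-- A diagonal factor scaling `m` and `-m` realises the prescribed entry `c`, and an elementary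
factor with column `z` at `a` realises the prescribed row `m`. Neither changes the core block. -/
theorem IsTop.exists_straight (hT : IsTop A τ Q a m) (hne : m ≠ a.swap)
    (hg : IsBorelOn (core A a m) g) {c : ℂ} (hc : c ≠ 0) (w : Fin n ⊕ Fin n → ℂ) :
    ∃ g₂, IsBorelOn A g₂ ∧ (∀ q, q ≠ m → q ≠ a.swap → g₂ q m = 0) ∧
      g₂ a a * Q a m * g₂ m m = c ∧ restr (core A a m) g₂ = g ∧
      ∀ q ∈ rowSet A a m, (g₂ * Q * g₂ᵀ) m q = w q := by
  have hQ := hT.form_top_ne_zero hne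
  have hmA := hT.partner_mem
  have hgt := hT.neg_lt_partner hne
  have ham : a ≠ m.swap := fun h => hne (swap_eq_iff.1 h.symm)
  -- When `a = m` the entry scales by `s²`, so a complex square root is needed.
  obtain ⟨s, hs⟩ : ∃ s : ℂ, (if a = m then s else 1) * Q a m * s = c := by
    by_cases h : a = m
    · obtain ⟨z, hz⟩ := IsAlgClosed.exists_pow_nat_eq (c / Q a m) (n := 2) (by norm_num)
      refine ⟨z, ?_⟩
      rw [if_pos h]
      field_simp at hz
      linear_combination hz
    · exact ⟨c / Q a m, by rw [if_neg h]; field_simp⟩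
  have hs0 : s ≠ 0 := right_ne_zero_of_mul (hs ▸ hc)
  let d : Fin n ⊕ Fin n → ℂ := fun r => if r = m then s else if r = m.swap then s⁻¹ else 1
  have hdm : d m = s := if_pos rfl
  have hda : d a = if a = m then s else 1 := by
    simp only [d, if_neg ham]
  have hd1 : ∀ r ∈ core A a m, d r = 1 := fun r hr => by
    have := mem_core.1 hr
    simp only [d, if_neg this.2.2.2.1, if_neg this.2.2.2.2]
  have hd : IsBorelOn A (Matrix.diagonal d) := by
    refine isBorelOn_diagonal (fun r => ?_) fun r hr => ?_
    · simp only [d, swap_eq_iff, Sum.swap_swap]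
      by_cases h1 : r = m
      · have : m ≠ m.swap := (swap_ne m).symm
        simp [h1, this, hs0]
      · by_cases h2 : r = m.swap
        · have : m.swap ≠ m := swap_ne m
          simp [h2, this, hs0]
        · simp [h1, h2]
    · have h1 : r ≠ m := fun h => hr (h ▸ hmA)
      have h2 : r ≠ m.swap := fun h => hr (h ▸ hT.symm m hmA)
      simp only [d, if_neg h1, if_neg h2]
  -- The entry `(m, m)` receives `z m` from both the row and the column, hence the factor `1 / 2`
  -- there.
  let z : Fin n ⊕ Fin n → ℂ := fun q =>
    if q ∈ rowSet A a m then (if q = m then 1 / 2 else 1) * (w q / c) else 0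
  have hz : ∀ q, q ∉ rowSet A a m → z q = 0 := fun q hq => if_neg hq
  have hza : z a = 0 := hz a fun h => (mem_rowSet.1 h).2.2.1 rfl
  have hk : IsBorelOn A (elem a z) := by
    refine isBorelOn_elem hT.symm hT.mem fun r hr => ?_
    have hr' : r ∈ rowSet A a m := by
      by_contra h
      exact hr (hz r h)
    obtain ⟨h1, -, h2, -⟩ := mem_rowSet.1 hr'
    exact ⟨h1, lt_of_le_of_ne (hT.le r h1) fun h => h2 (wt_injective h)⟩
  have ha : a ∉ core A a m := by simp [mem_core]
  have hm : m ∉ core A a m := by simp [mem_core]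
  have hent : ∀ r q, r ≠ a.swap → (elem a z * (Matrix.diagonal d * g)) r q =
      d r * g r q + z r * (d a * if a = q then 1 else 0) := by
    intro r q hr
    rw [elem_mul_apply, if_neg hr, add_zero, Matrix.diagonal_mul, Matrix.diagonal_mul,
      hg.outside a q (Or.inl ha)]
  have hzm : ∀ q, z q * (d a * if a = m then 1 else 0) = 0 := by
    intro q
    split_ifs with h
    · rw [hz q fun h' => (mem_rowSet.1 h').2.2.2 h.symm, zero_mul]
    · ring
  have haa : a ≠ a.swap := (swap_ne a).symm
  refine ⟨elem a z * (Matrix.diagonal d * g), hk.mul (hd.mul (hg.mono core_subset)), ?_, ?_, ?_, ?_⟩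
  · intro q hqm hqa
    rw [hent q m hqa, hzm, hg.outside q m (Or.inr hm), if_neg hqm, mul_zero, add_zero]
  · rw [hent a a haa, hent m m hne, hzm, hza, hg.outside a a (Or.inl ha),
      hg.outside m m (Or.inl hm), if_pos rfl, if_pos rfl, hda, hdm, ← hs]
    ring
  · ext r q
    simp only [restr]
    by_cases h : r ∈ core A a m ∧ q ∈ core A a m
    · have hr := mem_core.1 h.1
      have hq := mem_core.1 h.2
      rw [if_pos h, hent r q hr.2.2.1, hd1 r h.1, if_neg hq.2.1.symm]
      ring
    · rw [if_neg h, hg.outside r q (by tauto)]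
  · intro q hq
    obtain ⟨hqA, hq1, hqa, hma⟩ := mem_rowSet.1 hq
    have hqa' : q ≠ a.swap := by
      rintro rfl
      have := hT.le m hmA
      rw [wt_swap] at hq1
      omega
    have ham' : ¬ a = m := fun h => hma h.symm
    rw [if_neg ham', one_mul] at hs
    rw [if_neg ham'] at hda
    have hQs : Q m a = Q a m := hT.form_symm m a
    have hrow : ∀ x, (elem a z * (Matrix.diagonal d * g)) m x =
        (if x = m then s else 0) + if x = a then z m else 0 := by
      intro x
      rw [hent m x hne, hg.outside m x (Or.inl hm), hdm, hda]
      simp only [eq_comm]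
      split_ifs <;> ring
    have hQ1 : ∀ y, Q m y = if y = a then Q a m else 0 := by
      intro y
      split_ifs with h
      · rw [h, hQs]
      · by_contra h'
        rcases hT.form_cases h' with ⟨h1, -⟩ | ⟨h1, -⟩ | ⟨-, h1⟩
        · exact hm h1
        · exact hma h1
        · exact h h1
    have hQ2 : ∀ y, Q a y = if y = m then Q a m else 0 := by
      intro y
      split_ifs with h
      · rw [h]
      · by_contra h'
        rcases hT.form_cases h' with ⟨h1, -⟩ | ⟨-, h1⟩ | ⟨h1, -⟩
        · exact ha h1
        · exact h h1
        · exact hma h1.symm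
    have hsum : ((elem a z * (Matrix.diagonal d * g)) * Q *
        (elem a z * (Matrix.diagonal d * g))ᵀ) m q =
        s * Q a m * (elem a z * (Matrix.diagonal d * g)) q a +
          z m * Q a m * (elem a z * (Matrix.diagonal d * g)) q m := by
      rw [conj_apply]
      generalize elem a z * (Matrix.diagonal d * g) = E at hrow ⊢
      rw [Finset.sum_eq_add_of_mem m a (Finset.mem_univ _) (Finset.mem_univ _) hma]
      · rw [Finset.sum_eq_single a, Finset.sum_eq_single m, hrow, hrow, if_pos rfl, if_neg hma,
          if_neg ham', if_pos rfl, hQs, add_zero, zero_add]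
        · intro y _ hy
          rw [hQ2 y, if_neg hy]
          ring
        · simp
        · intro y _ hy
          rw [hQ1 y, if_neg hy]
          ring
        · simp
      · intro x _ hx
        refine Finset.sum_eq_zero fun y _ => ?_
        rw [hrow, if_neg hx.1, if_neg hx.2]
        ring
    rw [hsum, hent q a hqa', hent q m hqa', hzm, hg.outside q a (Or.inr ha),
      hg.outside q m (Or.inr hm), if_neg hqa, if_pos rfl, hda]
    have hzq : z q = (if q = m then 1 / 2 else 1) * (w q / c) := if_pos hq
    by_cases h : q = m
    · subst h
      rw [if_pos rfl] at hzq
      rw [if_pos rfl, hdm, hzq]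
      field_simp
      linear_combination (2 * w q) * hs
    · rw [if_neg h] at hzq
      rw [if_neg h, hzq]
      field_simp
      linear_combination (w q) * hs

/-- The largest index is not fixed by `τ`: the orbit is the product of a cell and the orbit for the
remaining indices. -/
theorem IsTop.isCell_of_not_fixed (hT : IsTop A τ Q a m) (hne : m ≠ a.swap) {k : ℕ}
    (ih : IsCell (orbitFamily (core A a m) (coreForm A a m Q)) k) :
    IsCell (orbitFamily A Q) ((topSet A a m).card + (rowSet A a m).card + k) := by
  obtain ⟨κ, iκ, E, G', hcard, hG', hF', hrange⟩ := ih
  have hmt := hT.partner_mem_topSet hne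
  have hQ := hT.form_top_ne_zero hne
  have hgt := hT.neg_lt_partner hne
  let u : {g // IsBorelOn A g} → Fin n ⊕ Fin n → ℂ := fun g q => orbitFamily A Q g (a, q)
  have hu : ∀ g : {g // IsBorelOn A g}, ∀ q, - wt a < wt q →
      u g q = g.1 a a * Q a m * g.1 q m := by
    intro g q hq
    change trunc (g.1 * Q * g.1ᵀ) a q = _
    rw [trunc_apply (by omega), hT.conj_row_top g.2]
  have hum : ∀ g, u g m ≠ 0 := fun g => by
    rw [hu g m hgt]
    exact mul_ne_zero (mul_ne_zero (g.2.diag_ne_zero a) hQ) (g.2.diag_ne_zero m)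
  let v := fun g => vcol A a m (u g)
  let g₁ : {g // IsBorelOn A g} → Matrix (Fin n ⊕ Fin n) (Fin n ⊕ Fin n) ℂ := fun g =>
    elem m (fun r => - v g r) * g.1
  have hg₁ : ∀ g, IsBorelOn A (g₁ g) := fun g => (hT.isBorelOn_elem_neg_vcol _).mul g.2
  have hcol : ∀ g q, q ≠ m → q ≠ a.swap → g₁ g q m = 0 := fun g =>
    hT.straighten hne g.2 (mul_ne_zero (g.2.diag_ne_zero a) hQ) fun q _ hq => hu g q hq
  have hv : ∀ g, IsBorelOn A (elem m (v g)) := fun g => hT.isBorelOn_elem_vcol _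
  have hv' : ∀ g, IsBorelOn A (elem m fun r => - v g r) := fun g => hT.isBorelOn_elem_neg_vcol _
  let π : {g // IsBorelOn A g} → {g // IsBorelOn (core A a m) g} := fun g =>
    ⟨_, hT.isBorelOn_restr_core (hg₁ g) (hcol g)⟩
  let N := fun g => trunc (g₁ g * Q * (g₁ g)ᵀ)
  have hdiag : ∀ g r, g₁ g r r = g.1 r r := fun g r => by
    change (elem m (fun r => - v g r) * g.1) r r = _
    rw [(hv' g).mul_diag g.2, elem_diag (by simp [v, vcol_self]), one_mul]
  -- Straightening and its inverse (`hM`) are written through truncated forms only; this is what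
  -- makes both changes of coordinates regular.
  have hN : ∀ g, N g = trunc (elem m (fun r => - v g r) * trunc (g.1 * Q * g.1ᵀ) *
      (elem m fun r => - v g r)ᵀ) := fun g => by
    rw [trunc_conj (hv' g)]
    simp only [N, g₁, Matrix.transpose_mul, Matrix.mul_assoc]
  have hM : ∀ g : {g // IsBorelOn A g}, trunc (g.1 * Q * g.1ᵀ) =
      trunc (elem m (v g) * N g * (elem m (v g))ᵀ) := fun g => by
    have h1 : elem m (v g) * g₁ g = g.1 := by
      rw [← Matrix.mul_assoc, elem_mul_elem_neg (vcol_self _), Matrix.one_mul]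
    rw [trunc_conj (hv g)]
    conv_lhs => rw [← h1]
    simp only [Matrix.transpose_mul, Matrix.mul_assoc]
  have hrec : ∀ g, N g = trunc (recon a m (u g m)
      (fun q => if q ∈ rowSet A a m then N g m q else 0)
      (orbitFamily (core A a m) (coreForm A a m Q) (π g))) := fun g => by
    have h1 := hT.conj_eq_recon (hg₁ g) (hcol g)
    rw [hdiag, hdiag, ← hu g m hgt] at h1
    have h2 : ∀ q, (if q ∈ rowSet A a m then (g₁ g * Q * (g₁ g)ᵀ) m q else 0) =
        if q ∈ rowSet A a m then N g m q else 0 := by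
      intro q
      split_ifs with h
      · exact (trunc_apply (mem_rowSet.1 h).2.1).symm
      · rfl
    simp only [h2] at h1
    exact h1
  -- The coordinates are the row `a` up to the place `m` (beyond it the row vanishes), the row `m`
  -- after straightening, and those of the core orbit. Among the entries of the two rows only `u g
  -- m` must be nonzero.
  let G : {g // IsBorelOn A g} → (topSet A a m ⊕ rowSet A a m) ⊕ κ → ℂ := fun g =>
    Sum.elim (Sum.elim (fun q => u g q) fun q => N g m q) (G' (π g))
  have hvF : ∀ q, (fun g => v g q) ∈ Reg (orbitFamily A Q) := by
    intro q
    simp only [v, vcol]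
    split_ifs
    · exact mul_mem_reg (const_mem_reg _ _)
        (div_mem_reg (coord_mem_reg _ (a, q)) (coord_mem_reg _ (a, m)) hum)
    · exact mul_mem_reg (const_mem_reg _ _)
        (div_mem_reg (coord_mem_reg _ (a, q)) (coord_mem_reg _ (a, m)) hum)
    · exact const_mem_reg _ 0
  have hNF : ∀ r q, (fun g => N g r q) ∈ Reg (orbitFamily A Q) := by
    intro r q
    simp only [hN]
    exact trunc_conj_mem_reg (elem_mem_reg fun q => neg_mem_reg (hvF q))
      (fun r q => coord_mem_reg (orbitFamily A Q) (r, q)) r q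
  have hyF : ∀ p, (fun g => orbitFamily (core A a m) (coreForm A a m Q) (π g) p) ∈
      Reg (orbitFamily A Q) := by
    rintro ⟨r, q⟩
    by_cases hrq : r ∈ core A a m ∧ q ∈ core A a m ∧ 0 < wt r + wt q
    · have hr := mem_core.1 hrq.1
      have hq := mem_core.1 hrq.2.1
      convert hNF r q using 2 with g
      rw [hrec, trunc_apply hrq.2.2, recon, if_neg hr.2.1, if_neg hq.2.1, if_neg hr.2.2.2.1,
        if_neg hq.2.2.2.1]
    · have h0 : ∀ g, orbitFamily (core A a m) (coreForm A a m Q) (π g) (r, q) = 0 := by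
        intro g
        simp only [orbitFamily, trunc]
        split_ifs with h
        · by_cases hr : r ∈ core A a m
          · rw [hT.core_isDatum.conj_symm]
            exact hT.core_isDatum.conj_eq_zero_of_notMem (π g).2 fun hq => hrq ⟨hr, hq, h⟩
          · exact hT.core_isDatum.conj_eq_zero_of_notMem (π g).2 hr
        · rfl
      simp only [h0]
      exact const_mem_reg _ 0
  have hcoordG : ∀ q ∈ topSet A a m, (fun g => u g q) ∈ Reg G := fun q hq =>
    coord_mem_reg G (Sum.inl (Sum.inl ⟨q, hq⟩))
  have hvG : ∀ q, (fun g => v g q) ∈ Reg G := by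
    intro q
    simp only [v, vcol]
    by_cases hq : q ∈ A ∧ - wt a < wt q ∧ wt q < wt m
    · simp only [if_pos hq]
      exact mul_mem_reg (const_mem_reg _ _)
        (div_mem_reg (hcoordG q (mem_topSet.2 ⟨hq.1, hq.2.1, hq.2.2.le⟩)) (hcoordG m hmt) hum)
    · simp only [if_neg hq]
      exact const_mem_reg _ 0
  have hyG : ∀ p, (fun g => orbitFamily (core A a m) (coreForm A a m Q) (π g) p) ∈ Reg G :=
    fun p => reg_le (fun k => coord_mem_reg G (Sum.inr k)) (comp_mem_reg (hF' p) π)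
  have hwG : ∀ q, (fun g => if q ∈ rowSet A a m then N g m q else 0) ∈ Reg G := by
    intro q
    by_cases hq : q ∈ rowSet A a m
    · simp only [if_pos hq]
      exact coord_mem_reg G (Sum.inl (Sum.inr ⟨q, hq⟩))
    · simp only [if_neg hq]
      exact const_mem_reg _ 0
  have hNG : ∀ r q, (fun g => N g r q) ∈ Reg G := by
    intro r q
    have h1 : (fun g => N g r q) = fun g => trunc (recon a m (u g m)
      (fun q => if q ∈ rowSet A a m then N g m q else 0)
      (orbitFamily (core A a m) (coreForm A a m Q) (π g))) r q :=
      funext fun g => congrFun (congrFun (hrec g) r) q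
    rw [h1]
    unfold trunc recon
    split_ifs
    all_goals first
      | exact const_mem_reg _ 0
      | exact hcoordG m hmt
      | exact hwG _
      | exact hyG _
  refine ⟨(topSet A a m ⊕ rowSet A a m) ⊕ κ, inferInstance,
    {e | Sum.elim (Sum.elim (fun q => q.1 = m) fun _ => False) (fun e => e ∈ E) e}, G,
    by simp [hcard], ?_, ?_, ?_⟩
  · rintro ((q | q) | k)
    · exact coord_mem_reg _ (a, q.1)
    · exact hNF m q
    · exact reg_le hyF (comp_mem_reg (hG' k) π)
  · rintro ⟨r, q⟩
    have h1 : (fun g => orbitFamily A Q g (r, q)) = fun g =>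
        trunc (elem m (v g) * trunc (g₁ g * Q * (g₁ g)ᵀ) * (elem m (v g))ᵀ) r q :=
      funext fun g => congrFun (congrFun (hM g) r) q
    rw [h1]
    exact trunc_conj_mem_reg (elem_mem_reg hvG) hNG r q
  · apply subset_antisymm
    · rintro _ ⟨g, rfl⟩ e he
      rcases e with (⟨q, hq⟩ | q) | e
      · have : q = m := he
        subst this
        exact hum g
      · exact he.elim
      · have : G' (π g) ∈ torusCell E := hrange ▸ Set.mem_range_self _
        exact this e he
    · intro t ht
      have hr' : (fun k => t (Sum.inr k)) ∈ Set.range G' := by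
        rw [hrange]
        exact fun e he => ht (Sum.inr e) he
      obtain ⟨g', hg'⟩ := hr'
      let u₀ : Fin n ⊕ Fin n → ℂ := fun q =>
        if hq : q ∈ topSet A a m then t (Sum.inl (Sum.inl ⟨q, hq⟩)) else 0
      have hu₀ : u₀ m ≠ 0 := by
        simp only [u₀, dif_pos hmt]
        exact ht (Sum.inl (Sum.inl ⟨m, hmt⟩)) rfl
      -- A straight matrix realises the entry `(a, m)`, the row `m` and the core; multiplying by the
      -- unipotent matrix of `u₀` produces the rest of the row `a`. Straightening reads off that
      -- same unipotent matrix and undoes it.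
      obtain ⟨g₂, hg₂, hcol₂, hc₂, hres₂, hw₂⟩ := hT.exists_straight hne g'.2 hu₀ fun q =>
        if hq : q ∈ rowSet A a m then t (Sum.inl (Sum.inr ⟨q, hq⟩)) else 0
      let g : {g // IsBorelOn A g} := ⟨elem m (vcol A a m u₀) * g₂,
        (hT.isBorelOn_elem_vcol u₀).mul hg₂⟩
      have hug : ∀ q ∈ topSet A a m, u g q = u₀ q := by
        intro q hq
        have hqa := (mem_topSet.1 hq).2.1
        rw [hu g q hqa]
        have e1 : g.1 a a = g₂ a a := by
          change (elem m (vcol A a m u₀) * g₂) a a = _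
          rw [(hT.isBorelOn_elem_vcol u₀).mul_diag hg₂, elem_diag (vcol_self _), one_mul]
        have e2 : g.1 q m = u₀ q / u₀ m * g₂ m m := by
          change (elem m (vcol A a m u₀) * g₂) q m = _
          rw [Matrix.mul_apply, Finset.sum_eq_single m, elem_vcol_col hu₀ hq]
          · intro x _ hx
            by_cases hxa : x = a.swap
            · rw [(hT.isBorelOn_elem_vcol u₀).upper q x (by rw [hxa, wt_swap]; exact hqa), zero_mul]
            · rw [hcol₂ x hx hxa, mul_zero]
          · simp
        rw [e1, e2, mul_comm (u₀ q / u₀ m), ← mul_assoc, hc₂]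
        field_simp
      have hvg : v g = vcol A a m u₀ := vcol_congr hmt hug
      have hgg : g₁ g = g₂ := by
        change elem m (fun r => - v g r) * (elem m (vcol A a m u₀) * g₂) = g₂
        rw [hvg, ← Matrix.mul_assoc, elem_neg_mul_elem (vcol_self _), Matrix.one_mul]
      have hπg : π g = g' := Subtype.ext (by
        change restr (core A a m) (g₁ g) = _
        rw [hgg, hres₂])
      refine ⟨g, funext fun e => ?_⟩
      rcases e with (⟨q, hq⟩ | ⟨q, hq⟩) | e
      · change u g q = _
        rw [hug q hq]
        exact dif_pos hq
      · change trunc (g₁ g * Q * (g₁ g)ᵀ) m q = _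
        rw [trunc_apply (mem_rowSet.1 hq).2.1, hgg, hw₂ q hq, dif_pos hq]
      · change G' (π g) e = _
        rw [hπg, hg']

theorem IsDatum.isCell (hD : IsDatum A τ Q) : IsCell (orbitFamily A Q) (inversions A τ).card := by
  induction hk : A.card using Nat.strong_induction_on generalizing A Q with
  | _ k ih =>
  rcases A.eq_empty_or_nonempty with rfl | hA
  · refine ⟨Empty, inferInstance, ∅, fun _ => Empty.elim, by simp [inversions],
      fun k => k.elim, fun p => ?_, ?_⟩
    · have h0 : ∀ g, orbitFamily ∅ Q g p = 0 := fun g => by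
        simp only [orbitFamily, trunc, hD.conj_eq_zero_of_notMem g.2 (Finset.notMem_empty _),
          ite_self]
      simp only [h0]
      exact const_mem_reg _ 0
    · ext t
      simp only [Set.mem_range, torusCell, Set.mem_empty_iff_false, false_imp_iff, implies_true,
        Set.mem_ofPred_eq, iff_true]
      -- The orbit is a single point, a cell with no factors; the unit matrix shows that it is
      -- nonempty.
      refine ⟨⟨1, ?_, one_mem _, fun r q _ => Matrix.one_apply⟩, Subsingleton.elim _ _⟩
      intro r q hrq
      refine Matrix.one_apply_ne fun h => ?_
      subst h
      exact lt_irrefl _ hrq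
  · obtain ⟨a, ha, hmax⟩ := A.exists_max_image wt hA
    have hT : IsTop A τ Q a (τ a).swap := ⟨hD, ha, hmax, by rw [Sum.swap_swap]⟩
    have hlt : (core A a (τ a).swap).card < k := by
      rw [← hk]
      refine Finset.card_lt_card ⟨core_subset, fun h => ?_⟩
      exact (mem_core.1 (h ha)).2.1 rfl
    have ih' := ih _ hlt hT.core_isDatum rfl
    rw [hT.card_inversions]
    by_cases hm : (τ a).swap = a.swap
    · have h1 : A.filter (fun q => wt (τ q) < wt (τ a).swap) = ∅ := by
        rw [Finset.filter_eq_empty_iff]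
        intro q hq h
        have := hT.neg_le (hT.map_mem q hq)
        rw [hm, wt_swap] at h
        omega
      have h2 : rowSet A a (τ a).swap = ∅ := by
        rw [Finset.eq_empty_iff_forall_notMem]
        intro q hq
        obtain ⟨h1, h2, -⟩ := mem_rowSet.1 hq
        have := hmax q h1
        rw [hm, wt_swap] at h2
        omega
      rw [h1, h2, Finset.card_empty, zero_add, zero_add]
      exact hT.isCell_of_fixed hm ih'
    · rw [hT.card_topSet hm]
      exact hT.isCell_of_not_fixed hm ih'

end Cells

/-! ### Coadjoint orbits as orbits of symmetric forms -/

section Coadjoint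

variable {n : ℕ}

/-- The symmetric form that corresponds to `f_D`. -/
def formOf (D : Finset (PosRoot n)) : Matrix (Fin n ⊕ Fin n) (Fin n ⊕ Fin n) ℂ :=
  ∑ δ ∈ D, (Matrix.single δ.hi δ.lo 1 + Matrix.single δ.lo δ.hi 1)

theorem formOf_ne_zero {D : Finset (PosRoot n)} {r q : Fin n ⊕ Fin n} :
    formOf D r q ≠ 0 ↔ ∃ δ ∈ D, (δ.hi = r ∧ δ.lo = q) ∨ (δ.lo = r ∧ δ.hi = q) := by
  -- The entries are natural numbers, so contributions of different roots cannot cancel.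
  have h : formOf D r q = ((∑ δ ∈ D, ((if δ.hi = r ∧ δ.lo = q then 1 else 0) +
      if δ.lo = r ∧ δ.hi = q then 1 else 0) : ℕ) : ℂ) := by
    simp only [formOf, Matrix.sum_apply, Matrix.add_apply, Matrix.single_apply]
    push_cast
    rfl
  rw [h, Nat.cast_ne_zero, ne_eq, Finset.sum_eq_zero_iff]
  push Not
  refine exists_congr fun δ => and_congr_right fun _ => ?_
  split_ifs with h1 h2 h2
  · exact iff_of_true (by decide) (Or.inl h1)
  · exact iff_of_true (by decide) (Or.inl h1)
  · exact iff_of_true (by decide) (Or.inr h2)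
  · exact iff_of_false (by decide) (by tauto)

theorem isDatum_formOf {τ : Fin n ⊕ Fin n → Fin n ⊕ Fin n} (hswap : ∀ r, τ r.swap = (τ r).swap)
    (hinv : ∀ r, τ (τ r) = r) : IsDatum Finset.univ τ (formOf (suppOf τ)) where
  symm _ _ := Finset.mem_univ _
  map_mem _ _ := Finset.mem_univ _
  map_swap := hswap
  map_map := hinv
  form_symm r q := by
    simp only [formOf, Matrix.sum_apply, Matrix.add_apply, Matrix.single_apply]
    refine Finset.sum_congr rfl fun δ _ => ?_
    rw [add_comm]
    simp only [and_comm]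
  form_ne_zero r q := by
    rw [formOf_ne_zero]
    constructor
    · rintro ⟨δ, hδ, ⟨rfl, rfl⟩ | ⟨rfl, rfl⟩⟩
      · have h := δ.hi_add_lo
        rw [mem_suppOf] at hδ
        rw [hδ, Sum.swap_swap, wt_swap]
        exact ⟨Finset.mem_univ _, rfl, by omega⟩
      · have h := δ.hi_add_lo
        rw [mem_suppOf, ← swap_eq_iff, ← hswap] at hδ
        have h' : τ δ.lo = δ.hi.swap := by rw [← hδ, hinv]
        rw [h', Sum.swap_swap, wt_swap]
        exact ⟨Finset.mem_univ _, rfl, by omega⟩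
    · rintro ⟨-, rfl, h⟩
      rcases le_total (wt (τ r).swap) (wt r) with h1 | h1
      · obtain ⟨δ, rfl, h2⟩ := PosRoot.exists_hi_lo h1 (by rw [wt_swap]; omega)
        exact ⟨δ, mem_suppOf.2 (by rw [h2, Sum.swap_swap]), Or.inl ⟨rfl, h2⟩⟩
      · obtain ⟨δ, h2, rfl⟩ := PosRoot.exists_hi_lo h1 (by rw [wt_swap]; omega)
        exact ⟨δ, mem_suppOf.2 (by rw [h2, hswap, hinv]), Or.inr ⟨rfl, h2⟩⟩

theorem rootBasis_coord (α : PosRoot n) (x : nil n) :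
    (rootBasis n).coord α x = x.1 α.hi.swap α.lo := by
  have h : x = ∑ β : PosRoot n, x.1 β.entry.1 β.entry.2 • rootBasis n β := by
    refine eq_of_entry fun β => ?_
    have h1 : ∀ β, rootBasis n β = (⟨β.mat, β.mat_mem⟩ : nil n) := fun β =>
      Subtype.ext (rootBasis_apply β)
    simp only [h1]
    exact (sum_entry (fun α => x.1 α.entry.1 α.entry.2) β).symm
  have h2 : (rootBasis n).coord α x = x.1 α.entry.1 α.entry.2 := by
    conv_lhs => rw [h, Module.Basis.coord_apply, Module.Basis.repr_sum_self]
  rw [h2]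
  rcases α with ⟨i, j, h⟩ | ⟨i, j, h⟩ | ⟨i⟩ <;> rfl

theorem fD_apply (D : Finset (PosRoot n)) (x : nil n) :
    fD D x = ∑ δ ∈ D, x.1 δ.hi.swap δ.lo := by
  simp only [fD, LinearMap.sum_apply, rootBasis_coord]

/-- The multiplicity with which the two matrix units of `e_α` coincide. -/
def PosRoot.mult (α : PosRoot n) : ℂ := if α.hi = α.lo then 2 else 1

theorem PosRoot.mult_ne_zero (α : PosRoot n) : α.mult ≠ 0 := by
  simp only [mult]
  split_ifs <;> norm_num

/-- The factor `mult` makes one formula valid for all roots: for a long root the two matrix units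
coincide and add up to twice `e_α`. The same doubling occurs on the diagonal of `formOf`. -/
theorem PosRoot.mult_smul_mat (α : PosRoot n) : α.mult • α.mat =
    Matrix.single α.hi.swap α.lo 1 + sgn α.lo • Matrix.single α.lo.swap α.hi 1 := by
  rcases α with ⟨i, j, h⟩ | ⟨i, j, h⟩ | ⟨i⟩
  · simp [mult, hi, lo, mat, sgn, sub_eq_add_neg]
  · simp [mult, hi, lo, mat, sgn, h.ne]
  · simp [mult, hi, lo, mat, sgn, two_smul]

theorem sgn_hi (α : PosRoot n) : sgn α.hi = 1 := by rcases α with _ | _ | _ <;> rfl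

theorem coe_inv_apply (g : Matrix.symplecticGroup (Fin n) ℂ) (r q : Fin n ⊕ Fin n) :
    (g⁻¹).1 r q = sgn r * sgn q * g.1 q.swap r.swap := by
  have h : (g⁻¹).1 = - (Matrix.J (Fin n) ℂ * (g.1ᵀ * Matrix.J (Fin n) ℂ)) := by
    rw [SymplecticGroup.coe_inv, Matrix.neg_mul, Matrix.neg_mul, Matrix.mul_assoc]
  rw [h, Matrix.neg_apply, J_mul_apply, mul_J_apply, Matrix.transpose_apply]
  ring

theorem mul_single_mul_apply (a b : Matrix (Fin n ⊕ Fin n) (Fin n ⊕ Fin n) ℂ)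
    (i j r q : Fin n ⊕ Fin n) : (a * Matrix.single i j (1 : ℂ) * b) r q = a r i * b j q := by
  simp [Matrix.mul_apply, Matrix.single_apply, ite_and]

/-- Evaluating `f_D` on `g⁻¹ e_α g` gives products of an entry of `g⁻¹` and an entry of `g`. By
`coe_inv_apply` the former is an entry of `g` with swapped, negated indices, and the sum becomes an
entry of a congruence transform. -/
theorem mult_mul_coAd (g : borel n) (D : Finset (PosRoot n)) (α : PosRoot n) :
    α.mult * coAd g (fD D) (rootBasis n α) = (g.1.1 * formOf D * g.1.1ᵀ) α.hi α.lo := by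
  have h1 : coAd g (fD D) (rootBasis n α) =
      ∑ δ ∈ D, ((g⁻¹).1.1 * α.mat * g.1.1) δ.hi.swap δ.lo := by
    change fD D (Ad g⁻¹ (rootBasis n α)) = _
    rw [fD_apply]
    refine Finset.sum_congr rfl fun δ _ => ?_
    change ((g⁻¹).1.1 * (rootBasis n α).1 * (g⁻¹⁻¹).1.1) _ _ = _
    rw [rootBasis_apply, inv_inv]
  rw [h1, Finset.mul_sum, formOf, Matrix.mul_sum, Matrix.sum_mul, Matrix.sum_apply]
  refine Finset.sum_congr rfl fun δ _ => ?_
  rw [← smul_eq_mul, ← Matrix.smul_apply, ← Matrix.smul_mul, ← Matrix.mul_smul,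
    PosRoot.mult_smul_mat, Matrix.mul_add, Matrix.add_mul, Matrix.add_apply, Matrix.mul_smul,
    Matrix.smul_mul, Matrix.smul_apply, mul_single_mul_apply, mul_single_mul_apply,
    Matrix.mul_add, Matrix.add_mul, Matrix.add_apply, mul_single_mul_apply, mul_single_mul_apply]
  change (g.1⁻¹).1 _ _ * _ + sgn α.lo • ((g.1⁻¹).1 _ _ * _) = _
  simp only [coe_inv_apply, sgn_swap, sgn_hi, Sum.swap_swap, smul_eq_mul, Matrix.transpose_apply]
  linear_combination (g.1.1 α.lo δ.hi * g.1.1 α.hi δ.lo) * sgn_mul_sgn α.lo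

theorem isBorelOn_univ {g : borel n} : IsBorelOn Finset.univ g.1.1 :=
  ⟨fun r q h => g.2 r q (pos_lt_pos_iff.2 h), g.1.2, fun r q h => by simp at h⟩

/-- The values on the `e_α` and the truncated entries of the form determine each other up to nonzero
constants and symmetry, so the cell structure carries over to the coadjoint orbit. -/
theorem IsDatum.isCell_orbit {τ : Fin n ⊕ Fin n → Fin n ⊕ Fin n} {D : Finset (PosRoot n)}
    (hD : IsDatum Finset.univ τ (formOf D)) :
    IsCell (fun (f : orbit (fD D)) (α : PosRoot n) => f.1 (rootBasis n α))
      (inversions Finset.univ τ).card := by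
  let π : {g // IsBorelOn (Finset.univ : Finset (Fin n ⊕ Fin n)) g} → borel n := fun g =>
    ⟨⟨g.1, g.2.symplectic⟩, fun i j h => g.2.upper i j (pos_lt_pos_iff.1 h)⟩
  have hπ : Function.Surjective fun g => (⟨coAd (π g) (fD D), π g, rfl⟩ : orbit (fD D)) := by
    rintro ⟨_, g, rfl⟩
    exact ⟨⟨g.1.1, isBorelOn_univ⟩, rfl⟩
  have hval : ∀ g (α : PosRoot n),
      α.mult * coAd (π g) (fD D) (rootBasis n α) = orbitFamily _ (formOf D) g (α.hi, α.lo) :=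
    fun g α => by
      rw [mult_mul_coAd]
      exact (trunc_apply α.hi_add_lo).symm
  refine IsCell.of_surjective hπ (hD.isCell.congr (fun α => ?_) ?_)
  · have h : (fun g => coAd (π g) (fD D) (rootBasis n α)) =
        fun g => α.mult⁻¹ * orbitFamily _ (formOf D) g (α.hi, α.lo) := by
      funext g
      rw [← hval, inv_mul_cancel_left₀ α.mult_ne_zero]
    exact h ▸ mul_mem_reg (const_mem_reg _ _) (coord_mem_reg _ _)
  · have main : ∀ α : PosRoot n, (fun g => orbitFamily _ (formOf D) g (α.hi, α.lo)) ∈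
        Reg fun g (α : PosRoot n) => coAd (π g) (fD D) (rootBasis n α) := by
      intro α
      simp only [← hval]
      exact mul_mem_reg (const_mem_reg _ _)
        (coord_mem_reg (fun g (α : PosRoot n) => coAd (π g) (fD D) (rootBasis n α)) α)
    rintro ⟨r, q⟩
    by_cases hrq : 0 < wt r + wt q
    · rcases le_total (wt q) (wt r) with h | h
      · obtain ⟨α, rfl, rfl⟩ := PosRoot.exists_hi_lo h hrq
        exact main α
      · obtain ⟨α, rfl, rfl⟩ := PosRoot.exists_hi_lo h (by omega)
        have hs : (fun g => orbitFamily Finset.univ (formOf D) g (α.lo, α.hi)) =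
            fun g => orbitFamily Finset.univ (formOf D) g (α.hi, α.lo) := by
          funext g
          change trunc _ _ _ = trunc _ _ _
          rw [trunc_apply hrq, trunc_apply α.hi_add_lo, hD.conj_symm]
        exact hs ▸ main α
    · have hs : (fun g => orbitFamily Finset.univ (formOf D) g (r, q)) = fun _ => 0 :=
        funext fun g => if_neg hrq
      exact hs ▸ const_mem_reg _ 0

theorem IsDatum.zariskiDim_orbit {τ : Fin n ⊕ Fin n → Fin n ⊕ Fin n} {D : Finset (PosRoot n)}
    (hD : IsDatum Finset.univ τ (formOf D)) :
    zariskiDim (orbit (fD D)) = ((inversions Finset.univ τ).card : WithBot ℕ∞) := by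
  let _ : TopologicalSpace (orbit (fD D)) := TopologicalSpace.induced Subtype.val (zariskiDual n)
  refine krullDim_of_isCell ?_ hD.isCell_orbit
  exact induced_compose

theorem ActsBy.map_map {σ : weylGroup n} {τ : Fin n ⊕ Fin n → Fin n ⊕ Fin n}
    (hτ : ActsBy σ.1 τ) (hσ : σ ^ 2 = 1) (r : Fin n ⊕ Fin n) : τ (τ r) = r := by
  apply sv_injective
  have h : σ.1 * σ.1 = 1 := by
    rw [pow_two] at hσ
    exact congrArg Subtype.val hσ
  rw [← hτ, ← hτ]
  exact DFunLike.congr_fun h (sv r)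

end Coadjoint

end TypeC

end

theorem theorem3p1 (n : ℕ) (σ : TypeC.weylGroup n) (hσ : σ ^ 2 = 1) :
    (∃! D : Finset (TypeC.PosRoot n), TypeC.IsSupport σ D) ∧
    ∀ D : Finset (TypeC.PosRoot n), TypeC.IsSupport σ D →
      TypeC.zariskiDim (TypeC.orbit (TypeC.fD D)) = (TypeC.length σ : WithBot ℕ∞) := by
  obtain ⟨τ, hτ⟩ := TypeC.exists_actsBy σ
  have hinv := hτ.map_map hσ
  refine ⟨⟨TypeC.suppOf τ, TypeC.isSupport_suppOf hτ hinv, fun D hD => hD.eq_suppOf hτ⟩, ?_⟩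
  intro D hD
  rw [hD.eq_suppOf hτ, TypeC.length_eq_card_inversions hτ]
  exact (TypeC.isDatum_formOf hτ.swap hinv).zariskiDim_orbit
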